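/- **Model.** Fix integers $R,K,d\ge 1$, $D=Rd$, weights $\pi(r)>0$ with $\sum_{r=1}^R\pi(r)=1$, weights $\pi_r(k)>0$ with $\sum_{k=1}^K\pi_r(k)=1$, and vectors $x_{r,k}\in\mathbb R^{D}$ ($r\in[R]$, $k\in[K]$). The $RK\times D$ matrix with rows $x_{r,k}^\top$ is written as $Z+\mathcal A$, where $Z$ is block diagonal with diagonal blocks $\xi_1,\dots,\xi_R\in\mathbb R^{K\times d}$ and the Hadamard product $Z\circ\mathcal A$ is $0$. Let $M\le R$ be the number of distinct elements of $\{\xi_1,\dots,\xi_R\}$ (the motifs). Let $F=\sum_r\pi(r)\sum_k\pi_r(k)\,\delta_{x_{r,k}}$. Assume that * all inner products $\langle x_{r,k},x_{s,l}\rangle$ lie in $[0,1]$; * (affinity) $p:=\max_{r\ne s}\max_{k,l}\langle x_{r,k},x_{s,l}\rangle<q:=\min_r\min_{k,l}\langle x_{r,k},x_{r,l}\rangle$; * the second moment matrix $\int xx^\top\,dF(x)$ has rank $D$. For each $n$ let $X_1,\dots,X_n$ be i.i.d. with law $F$ and, given $X$, let $G=G_n$ be the random graph on $[n]$ with independent edges,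 $ij$ being an edge with probability $\langle X_i,X_j\rangle$; let $A$ be its adjacency matrix. Let $H_r=\{i: X_i\in\{x_{r,1},\dots,x_{r,K}\}\}$. All parameters are fixed as $n\to\infty$. Events $E_n$ occur *asymptotically almost surely* if for every $c>0$ there is $n_0(c)$ such that $P(E_n)\ge 1-\eta$ whenever $n>n_0(c)$ and $n^{-c}<\eta<1/2$. **Algorithm.** An adjacency spectral embedding (ASE) into $\mathbb R^m$ of a symmetric matrix $B$ is $U S^{1/2}$, where $S$ is the diagonal matrix of the $m$ largest eigenvalues of $|B|=(B^\top B)^{1/2}$ in decreasing order and the columns of $U$ are corresponding orthonormal eigenvectors. 1. Compute an ASE of $A$ into $\mathbb R^D$, with rows $\widehat X_1,\dots,\widehat X_n$. 2. Start with a family of $R$ seeds that are rows of $\widehat X$ (repetitions allowed). For $i=1,\dots,n$, choose two different members $\tilde y,\tilde z$ of the family with maximal inner product; if $\max_s\langle\widehat X_i,s\rangle<\langle\tilde y,\tilde z\rangle$, the maximum being over all seeds $s$, replace $\tilde z$ by $\widehat X_i$; if it is $>$, do nothing; in case of equality do either. With the final seeds $s_1,\dots,s_R$, assign every vertex $i$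 to an index $j$ maximizing $\langle\widehat X_i,s_j\rangle$. Let $\widehat H_j$ consist of the vertex of $s_j$ and all vertices assigned to $j$. 3. For each $j$ compute an ASE $\widehat X_{\widehat H_j}$ into $\mathbb R^d$ of the adjacency matrix of the subgraph induced by $\widehat H_j$. 4. Let $\widehat S_{jk}=T(\widehat X_{\widehat H_j},\widehat X_{\widehat H_k})$, where for point families $(u_i)_{i\le a}$, $(v_k)_{k\le b}$ $$T(u,v)=\frac{1}{a(a-1)}\sum_{i\ne j}\kappa(u_i,u_j)-\frac{2}{ab}\sum_{i,k}\kappa(u_i,v_k)+\frac1{b(b-1)}\sum_{k\neq l}\kappa(v_k,v_l)$$ and $\kappa(u,v)=\varphi(\|u-v\|)$ is a radial kernel with $\varphi$ continuous (e.g. Gaussian). **Theorem.** (a) Asymptotically almost surely, the clustering is perfect: for all choices made in the algorithm (eigenvectors, initial seeds, ties) there is a permutation $\sigma$ of $[R]$ with $\widehat H_{\sigma(r)}=H_r$ for all $r\in[R]$. (b) Suppose in addition that every subgraph is $d$-dimensional, i.e. $\dim\operatorname{span}\{x_{r,1},\dots,x_{r,K}\}\le d$ for all $r$ (automatic if $\mathcal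 A=0$ or $K=d$). Then for every $\varepsilon>0$, asymptotically almost surely, for all choices made in the algorithm there is a permutation $\sigma$ as in (a) such that $$|\widehat S_{\sigma(r)\sigma(s)}-S_{rs}|\le\varepsilon\quad\text{for all } r,s\in[R],\qquad S_{rs}=T(Y_{H_r},Y_{H_s}).$$ Here $Y_{H_r}=(Y_i)_{i\in H_r}$ are the true latent positions of $H_r$ in $\mathbb R^d$, i.e. $\langle Y_i,Y_j\rangle=\langle X_i,X_j\rangle$ for $i,j\in H_r$; this determines them up to an orthogonal transformation, and $Y_{H_r}$ is any representative that is closest in Frobenius norm to $\widehat X_{\widehat H_{\sigma(r)}}$. -/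

import Mathlib

open MeasureTheory ProbabilityTheory

/-- "Asymptotically almost surely", in the quantitative sense: for every fixed `c > 0` there is
`n₀(c)` such that `P(Eₙ) ≥ 1 - η` whenever `n > n₀(c)` and `n ^ (-c) < η < 1/2`. -/
def AsympAlmostSurely {Ω : ℕ → Type*} [∀ n, MeasurableSpace (Ω n)]
    (μ : ∀ n, Measure (Ω n)) (E : ∀ n, Set (Ω n)) : Prop :=
  ∀ c : ℝ, 0 < c → ∃ n₀ : ℕ, ∀ n : ℕ, n₀ < n → ∀ η : ℝ,
    (n : ℝ) ^ (-c) < η → η < 1 / 2 → 1 - η ≤ (μ n).real (E n)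

section RandomDotProductGraph

/-- `∏_{i > j} ⟨x i, x j⟩ ^ {A_ij} (1 - ⟨x i, x j⟩) ^ {1 - A_ij}`, with `A` the adjacency matrix
of `G`. -/
noncomputable def edgeLikelihood {ι : Type*} [Fintype ι] {n : ℕ}
    (x : Fin n → EuclideanSpace ℝ ι) (G : SimpleGraph (Fin n)) : ℝ :=
  open Classical in
  ∏ i, ∏ j ∈ Finset.univ.filter (fun j => j < i),
    if G.Adj i j then inner ℝ (x i) (x j) else 1 - inner ℝ (x i) (x j)

/-- `(X, A) ∼ RDPG(F)` on `n` vertices: the latent positions `X i` are i.i.d. with law `F`, where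
`F` lives on a set with all inner products in `[0, 1]`, and given `X` the graph `A` is drawn with
independent edges, the edge `{i, j}` having probability `⟨X i, X j⟩`. -/
structure IsRDPG {ι : Type*} [Fintype ι] {n : ℕ} {Ω : Type*} [MeasurableSpace Ω]
    (F : Measure (EuclideanSpace ℝ ι)) (μ : Measure Ω)
    (X : Fin n → Ω → EuclideanSpace ℝ ι) (A : Ω → SimpleGraph (Fin n)) : Prop where
  admissible : ∃ 𝒳 : Set (EuclideanSpace ℝ ι), F 𝒳ᶜ = 0 ∧
    ∀ x ∈ 𝒳, ∀ y ∈ 𝒳, inner ℝ x y ∈ Set.Icc (0 : ℝ) 1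
  measurable_position : ∀ i, Measurable (X i)
  indep : iIndepFun X μ
  law : ∀ i, μ.map (X i) = F
  measurable_graph : ∀ G, MeasurableSet {ω | A ω = G}
  conditional_law : ∀ (B : Set (Fin n → EuclideanSpace ℝ ι)), MeasurableSet B →
    ∀ G : SimpleGraph (Fin n),
      μ {ω | (fun i => X i ω) ∈ B ∧ A ω = G} =
        ∫⁻ ω in {ω | (fun i => X i ω) ∈ B},
          ENNReal.ofReal (edgeLikelihood (fun i => X i ω) G) ∂μ

/-- The second moment matrix `E[X₁ X₁ᵀ]` of a distribution `F`. -/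
noncomputable def secondMoment {ι : Type*} [Fintype ι] (F : Measure (EuclideanSpace ℝ ι)) :
    Matrix ι ι ℝ :=
  Matrix.of fun a b => ∫ x, x a * x b ∂F

end RandomDotProductGraph

section HSBM

variable {R K d : ℕ}

/-- The entries of the block diagonal matrix `Z`; rows are indexed by (subgraph, block), columns
by `Fin R × Fin d`, so that the ambient dimension is `D = R d`. -/
def blockDiagEntry (ξ : Fin R → Fin K → Fin d → ℝ) (r : Fin R) (k : Fin K)
    (c : Fin R × Fin d) : ℝ :=
  if c.1 = r then ξ r k c.2 else 0

/-- The rows of `Z + 𝒜`: the latent position of block `k` of subgraph `r`. -/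
noncomputable def latentPosition (ξ : Fin R → Fin K → Fin d → ℝ)
    (𝒜 : Fin R → Fin K → Fin R × Fin d → ℝ) (r : Fin R) (k : Fin K) :
    EuclideanSpace ℝ (Fin R × Fin d) :=
  WithLp.toLp 2 fun c => blockDiagEntry ξ r k c + 𝒜 r k c

/-- `F = ∑ᵣ π(r) ∑ₖ πᵣ(k) δ_{x r k}`. -/
noncomputable def hsbmLaw {ι : Type*} [Fintype ι] (π : Fin R → ℝ) (πs : Fin R → Fin K → ℝ)
    (x : Fin R → Fin K → EuclideanSpace ℝ ι) : Measure (EuclideanSpace ℝ ι) :=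
  ∑ r, ENNReal.ofReal (π r) • ∑ k, ENNReal.ofReal (πs r k) • Measure.dirac (x r k)

/-- Affinity: the largest inner product `p` of latent positions in different subgraphs is smaller
than the smallest inner product `q` of latent positions in the same subgraph. -/
def Affinity {ι : Type*} [Fintype ι] (x : Fin R → Fin K → EuclideanSpace ℝ ι) : Prop :=
  ∃ p q : ℝ,
    IsLeast {t | ∃ r k l, t = inner ℝ (x r k) (x r l)} q ∧
    IsGreatest {t | ∃ r s k l, r ≠ s ∧ t = inner ℝ (x r k) (x s l)} p ∧
    p < q

/-- The vertex set of the `r`-th subgraph, for latent positions `X` of the vertices. -/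
noncomputable def trueSubgraph {ι : Type*} [Fintype ι] {n : ℕ}
    (x : Fin R → Fin K → EuclideanSpace ℝ ι) (X : Fin n → EuclideanSpace ℝ ι) (r : Fin R) :
    Finset (Fin n) :=
  open Classical in Finset.univ.filter fun i => ∃ k, X i = x r k

end HSBM

section Algorithm

/-- `Xhat = U_A S_A^{1/2}` is an adjacency spectral embedding of `A` into `ℝᵈ`. Here `B = |A|` is
the positive semidefinite square root of `Aᵀ A`, `lam` lists its eigenvalues in decreasing order
and `u` is a corresponding orthonormal basis of eigenvectors (any choice of it is allowed).
If there are fewer than `d` vertices, the missing columns are zero. -/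
def IsASE {V : Type*} [Fintype V] [DecidableEq V] {d : ℕ} (A : Matrix V V ℝ)
    (Xhat : V → EuclideanSpace ℝ (Fin d)) : Prop :=
  ∃ (B : Matrix V V ℝ)
    (u : OrthonormalBasis (Fin (Fintype.card V)) ℝ (EuclideanSpace ℝ V))
    (lam : Fin (Fintype.card V) → ℝ),
    B.PosSemidef ∧ B * B = A.transpose * A ∧ Antitone lam ∧
    (∀ k, Matrix.toEuclideanLin B (u k) = lam k • u k) ∧
    ∀ v a, Xhat v a =
      if h : (a : ℕ) < Fintype.card V then u ⟨a, h⟩ v * Real.sqrt (lam ⟨a, h⟩) else 0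

/-- Step `i` of the construction of the seeds. The `R` seeds are recorded by the vertices whose
rows of `Xhat` they are. A pair `y ≠ z` of seeds with maximal inner product is chosen; if no seed
has inner product with row `i` above that maximum, `z` is replaced by row `i`; if some seed has
inner product above it, nothing happens; in case of equality either may happen. -/
def SeedStep {R n D : ℕ} (Xhat : Fin n → EuclideanSpace ℝ (Fin D)) (i : Fin n)
    (s s' : Fin R → Fin n) : Prop :=
  ∃ y z : Fin R, y ≠ z ∧
    (∀ y' z' : Fin R, y' ≠ z' →
      inner ℝ (Xhat (s y')) (Xhat (s z')) ≤ inner ℝ (Xhat (s y)) (Xhat (s z))) ∧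
    (((∀ j, inner ℝ (Xhat i) (Xhat (s j)) ≤ inner ℝ (Xhat (s y)) (Xhat (s z))) ∧
        s' = Function.update s z i) ∨
      ((∃ j, inner ℝ (Xhat (s y)) (Xhat (s z)) ≤ inner ℝ (Xhat i) (Xhat (s j))) ∧
        s' = s))

/-- The `r`-th cluster: the seed `s r` together with all vertices assigned to it. -/
def cluster {R n : ℕ} (s : Fin R → Fin n) (τ : Fin n → Fin R) (r : Fin R) : Finset (Fin n) :=
  insert (s r) (Finset.univ.filter fun i => τ i = r)

/-- The statistic `T_{n,m}(X, Y)` for the points `X i`, `i ∈ H`, and `Y k`, `k ∈ H'`, with the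
radial kernel `κ(x, y) = φ(‖x - y‖)`; here `n = |H|` and `m = |H'|`. -/
noncomputable def testStatistic {V E : Type*} [DecidableEq V] [NormedAddCommGroup E]
    (φ : ℝ → ℝ) (H : Finset V) (X : V → E) (H' : Finset V) (Y : V → E) : ℝ :=
  1 / ((H.card : ℝ) * ((H.card : ℝ) - 1)) *
      (∑ i ∈ H, ∑ j ∈ H.erase i, φ ‖X i - X j‖)
    - 2 / ((H'.card : ℝ) * (H.card : ℝ)) * (∑ i ∈ H, ∑ k ∈ H', φ ‖X i - Y k‖)
    + 1 / ((H'.card : ℝ) * ((H'.card : ℝ) - 1)) *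
      (∑ k ∈ H', ∑ l ∈ H'.erase k, φ ‖Y k - Y l‖)

/-- The adjacency matrix of a graph. -/
noncomputable def adjacency {n : ℕ} (G : SimpleGraph (Fin n)) : Matrix (Fin n) (Fin n) ℝ :=
  open Classical in G.adjMatrix ℝ

/-- A run of the hierarchical structure detection algorithm (one level) on the graph `G`, with
all the choices it makes: the spectral embedding `Xhat` into `ℝ^{Rd}`, the successive seed
families (starting from any sample of `R` rows), the assignment of every vertex to a seed with
maximal inner product, and the spectral embeddings `XhatSub r` into `ℝᵈ` of the subgraphs induced
by the clusters (only the values of `XhatSub r` on the `r`-th cluster matter). -/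
structure AlgorithmRun (R d : ℕ) {n : ℕ} (G : SimpleGraph (Fin n)) where
  Xhat : Fin n → EuclideanSpace ℝ (Fin (R * d))
  seeds : Fin (n + 1) → Fin R → Fin n
  τhat : Fin n → Fin R
  XhatSub : Fin R → Fin n → EuclideanSpace ℝ (Fin d)
  isASE : IsASE (adjacency G) Xhat
  seedStep : ∀ i : Fin n, SeedStep Xhat i (seeds i.castSucc) (seeds i.succ)
  argmax : ∀ i j, inner ℝ (Xhat i) (Xhat (seeds (Fin.last n) j)) ≤
    inner ℝ (Xhat i) (Xhat (seeds (Fin.last n) (τhat i)))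
  isASE_sub : ∀ r, IsASE
    ((adjacency G).submatrix
      (fun v : {i // i ∈ cluster (seeds (Fin.last n)) τhat r} => (v : Fin n))
      (fun v : {i // i ∈ cluster (seeds (Fin.last n)) τhat r} => (v : Fin n)))
    (fun v : {i // i ∈ cluster (seeds (Fin.last n)) τhat r} => XhatSub r v)

/-- The estimated subgraph `Ĥ_r`, as a vertex set. -/
def AlgorithmRun.Hhat {R d n : ℕ} {G : SimpleGraph (Fin n)} (run : AlgorithmRun R d G)
    (r : Fin R) : Finset (Fin n) :=
  cluster (run.seeds (Fin.last n)) run.τhat r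

/-- The estimated dissimilarity matrix `Ŝ`. -/
noncomputable def AlgorithmRun.Shat {R d n : ℕ} {G : SimpleGraph (Fin n)}
    (run : AlgorithmRun R d G) (φ : ℝ → ℝ) : Matrix (Fin R) (Fin R) ℝ :=
  Matrix.of fun r s =>
    testStatistic φ (run.Hhat r) (run.XhatSub r) (run.Hhat s) (run.XhatSub s)

end Algorithm

section Latent

/-- `Y` gives `d`-dimensional latent positions of the subgraph on `H`, i.e. it reproduces the edge
probabilities `⟨X i, X j⟩`. Such a `Y` is determined up to an orthogonal transformation. -/
def IsLatentOn {V ι : Type*} [Fintype ι] {d : ℕ} (H : Finset V) (X : V → EuclideanSpace ℝ ι)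
    (Y : V → EuclideanSpace ℝ (Fin d)) : Prop :=
  ∀ i ∈ H, ∀ j ∈ H, inner ℝ (Y i) (Y j) = inner ℝ (X i) (X j)

/-- Among the `d`-dimensional latent positions of the subgraph on `H`, which are determined only
up to an orthogonal transformation, `Y` is a representative closest to `Xhat` in Frobenius norm
(orthogonal Procrustes alignment). -/
def IsAlignedLatent {V ι : Type*} [Fintype ι] {d : ℕ} (H : Finset V)
    (X : V → EuclideanSpace ℝ ι) (Xhat Y : V → EuclideanSpace ℝ (Fin d)) : Prop :=
  IsLatentOn H X Y ∧ ∀ Y' : V → EuclideanSpace ℝ (Fin d), IsLatentOn H X Y' →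
    ∑ i ∈ H, ‖Xhat i - Y i‖ ^ 2 ≤ ∑ i ∈ H, ‖Xhat i - Y' i‖ ^ 2

/-- The dissimilarity matrix `S` of the subgraphs on `H r` with latent positions `Y r`. -/
noncomputable def dissimilarity {R n d : ℕ} (φ : ℝ → ℝ) (H : Fin R → Finset (Fin n))
    (Y : Fin R → Fin n → EuclideanSpace ℝ (Fin d)) : Matrix (Fin R) (Fin R) ℝ :=
  Matrix.of fun r s => testStatistic φ (H r) (Y r) (H s) (Y s)

end Latent

section WellDefined

/-- Every real matrix has an adjacency spectral embedding. -/
theorem IsASE.exists {V : Type*} [Fintype V] [DecidableEq V] (d : ℕ) (A : Matrix V V ℝ) :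
    ∃ Xhat : V → EuclideanSpace ℝ (Fin d), IsASE A Xhat := by
  classical
  have hA : (A.transpose * A).PosSemidef := by
    have := Matrix.posSemidef_conjTranspose_mul_self A
    simpa [Matrix.conjTranspose_eq_transpose_of_trivial] using this
  obtain ⟨B, hB, hBB⟩ : ∃ B : Matrix V V ℝ, B.PosSemidef ∧ B * B = A.transpose * A := by
    open scoped MatrixOrder Matrix.Norms.L2Operator in
    refine ⟨CFC.sqrt (A.transpose * A), ?_, ?_⟩
    · exact Matrix.nonneg_iff_posSemidef.1 (CFC.sqrt_nonneg _)
    · exact CFC.sqrt_mul_sqrt_self _ (Matrix.nonneg_iff_posSemidef.2 hA)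
  refine ⟨fun v => WithLp.toLp 2 fun a => if h : (a : ℕ) < Fintype.card V then
    (hB.1.eigenvectorBasis.reindex
      ((Fintype.equivOfCardEq (Fintype.card_fin _)).symm)) ⟨a, h⟩ v *
      Real.sqrt (hB.1.eigenvalues₀ ⟨a, h⟩) else 0, B, _, hB.1.eigenvalues₀, hB, hBB,
    hB.1.eigenvalues₀_antitone, ?_, fun v a => rfl⟩
  intro k
  have h := hB.1.mulVec_eigenvectorBasis ((Fintype.equivOfCardEq (Fintype.card_fin _)) k)
  simp only [OrthonormalBasis.reindex_apply, Equiv.symm_symm]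
  ext i
  have h' := congrFun h i
  simpa [Matrix.toEuclideanLin, Matrix.IsHermitian.eigenvalues] using h'

/-- A seed step is always possible. -/
theorem SeedStep.exists {R n D : ℕ} (hR : 2 ≤ R) (Xhat : Fin n → EuclideanSpace ℝ (Fin D))
    (i : Fin n) (s : Fin R → Fin n) : ∃ s', SeedStep Xhat i s s' := by
  classical
  have hne : (Finset.univ.filter fun p : Fin R × Fin R => p.1 ≠ p.2).Nonempty :=
    ⟨(⟨0, by omega⟩, ⟨1, by omega⟩), by simp⟩
  obtain ⟨p, hp, hmax⟩ := Finset.exists_max_image _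
    (fun p : Fin R × Fin R => inner ℝ (Xhat (s p.1)) (Xhat (s p.2))) hne
  have hp' : p.1 ≠ p.2 := by simpa using hp
  have hm : ∀ y' z' : Fin R, y' ≠ z' →
      inner ℝ (Xhat (s y')) (Xhat (s z')) ≤ inner ℝ (Xhat (s p.1)) (Xhat (s p.2)) :=
    fun y' z' h => hmax (y', z') (by simpa using h)
  by_cases h : ∀ j, inner ℝ (Xhat i) (Xhat (s j)) ≤ inner ℝ (Xhat (s p.1)) (Xhat (s p.2))
  · exact ⟨_, p.1, p.2, hp', hm, Or.inl ⟨h, rfl⟩⟩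
  · push Not at h
    obtain ⟨j, hj⟩ := h
    exact ⟨s, p.1, p.2, hp', hm, Or.inr ⟨⟨j, hj.le⟩, rfl⟩⟩

/-- The algorithm always has a run. -/
theorem AlgorithmRun.nonempty {R d n : ℕ} (hR : 2 ≤ R) (hn : 0 < n) (G : SimpleGraph (Fin n)) :
    Nonempty (AlgorithmRun R d G) := by
  classical
  have : NeZero R := ⟨by omega⟩
  obtain ⟨Xhat, hX⟩ := IsASE.exists (R * d) (adjacency G)
  choose f hf using SeedStep.exists (n := n) hR Xhat
  let S : Fin (n + 1) → Fin R → Fin n :=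
    fun k => Fin.induction (motive := fun _ => Fin R → Fin n) (fun _ => ⟨0, hn⟩)
      (fun i s => f i s) k
  have hS : ∀ i : Fin n, SeedStep Xhat i (S i.castSucc) (S i.succ) := fun i => by
    have : S i.succ = f i (S i.castSucc) := by simp [S]
    rw [this]; exact hf _ _
  have hτ : ∀ i, ∃ t, ∀ j, inner ℝ (Xhat i) (Xhat (S (Fin.last n) j)) ≤
      inner ℝ (Xhat i) (Xhat (S (Fin.last n) t)) := fun i => by
    obtain ⟨t, -, ht⟩ := Finset.exists_max_image (Finset.univ : Finset (Fin R))
      (fun j => inner ℝ (Xhat i) (Xhat (S (Fin.last n) j))) ⟨0, by simp⟩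
    exact ⟨t, fun j => ht j (by simp)⟩
  choose τ hτ using hτ
  have hsub : ∀ r, ∃ Y : Fin n → EuclideanSpace ℝ (Fin d), IsASE ((adjacency G).submatrix
      (fun v : {i // i ∈ cluster (S (Fin.last n)) τ r} => (v : Fin n))
      (fun v : {i // i ∈ cluster (S (Fin.last n)) τ r} => (v : Fin n)))
      (fun v : {i // i ∈ cluster (S (Fin.last n)) τ r} => Y v) := fun r => by
    obtain ⟨Y, hY⟩ := IsASE.exists d ((adjacency G).submatrix
      (fun v : {i // i ∈ cluster (S (Fin.last n)) τ r} => (v : Fin n))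
      (fun v : {i // i ∈ cluster (S (Fin.last n)) τ r} => (v : Fin n)))
    refine ⟨fun i => if h : i ∈ cluster (S (Fin.last n)) τ r then Y ⟨i, h⟩ else 0, ?_⟩
    convert hY using 1
    ext v
    simp
  choose Y hY using hsub
  exact ⟨⟨Xhat, S, τ, Y, hX, hS, hτ, hY⟩⟩

/-- An aligned representative exists as soon as there are `d`-dimensional latent positions. -/
theorem IsAlignedLatent.exists {V ι : Type*} [Fintype V] [Fintype ι] {d : ℕ} (H : Finset V)
    (X : V → EuclideanSpace ℝ ι) (Xhat : V → EuclideanSpace ℝ (Fin d))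
    (h : ∃ Y : V → EuclideanSpace ℝ (Fin d), IsLatentOn H X Y) :
    ∃ Y, IsAlignedLatent H X Xhat Y := by
  classical
  obtain ⟨Y₀, h₀⟩ := h
  let C : Set (V → EuclideanSpace ℝ (Fin d)) :=
    {Y | IsLatentOn H X Y ∧ ∀ i ∉ H, Y i = 0}
  have hC : IsCompact C := by
    refine Metric.isCompact_of_isClosed_isBounded ?_ ?_
    · have : C = (⋂ i ∈ H, ⋂ j ∈ H, {Y : V → EuclideanSpace ℝ (Fin d) |
          inner ℝ (Y i) (Y j) = inner ℝ (X i) (X j)}) ∩ ⋂ i, ⋂ (_ : i ∉ H), {Y | Y i = 0} := by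
        ext Y; simp [C, IsLatentOn]
      rw [this]
      refine IsClosed.inter (isClosed_biInter fun i _ => isClosed_biInter fun j _ => ?_)
        (isClosed_iInter fun i => isClosed_iInter fun _ => ?_)
      · exact isClosed_eq (by fun_prop) (by fun_prop)
      · exact isClosed_eq (by fun_prop) (by fun_prop)
    · refine (Metric.isBounded_closedBall (x := 0) (r := ∑ i, ‖X i‖)).subset ?_
      intro Y hY
      rw [mem_closedBall_zero_iff, pi_norm_le_iff_of_nonneg (by positivity)]
      intro i
      by_cases hi : i ∈ H
      · have := hY.1 i hi i hi
        rw [real_inner_self_eq_norm_sq, real_inner_self_eq_norm_sq] at this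
        have e : ‖Y i‖ = ‖X i‖ := by
          exact (sq_eq_sq₀ (norm_nonneg _) (norm_nonneg _)).1 this
        rw [e]
        exact Finset.single_le_sum (f := fun i => ‖X i‖) (fun _ _ => norm_nonneg _)
          (Finset.mem_univ i)
      · rw [hY.2 i hi, norm_zero]; positivity
  have cut : ∀ Y : V → EuclideanSpace ℝ (Fin d), IsLatentOn H X Y →
      (fun i => if i ∈ H then Y i else 0) ∈ C := fun Y hY =>
    ⟨fun i hi j hj => by simpa [hi, hj] using hY i hi j hj, fun i hi => by simp [hi]⟩
  obtain ⟨Y, hY, hmin⟩ := hC.exists_isMinOn ⟨_, cut Y₀ h₀⟩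
    (f := fun Y => ∑ i ∈ H, ‖Xhat i - Y i‖ ^ 2) (by fun_prop)
  refine ⟨Y, hY.1, fun Y' h' => ?_⟩
  refine (hmin (cut Y' h')).trans (le_of_eq ?_)
  exact Finset.sum_congr rfl fun i hi => by simp [hi]

end WellDefined

/-! Write the adjacency matrix as `A = P + E`, with `P = Q Q*` the Gram matrix of the latent
positions. The second moment matrix is invertible, so the positions span; each of them is taken by a
positive proportion of the vertices, so the nonzero eigenvalues of `P` are at least `l n`. The noise
satisfies `‖E‖ ≤ δ n`: the diagonal of `E²` is at most `n`, and an off-diagonal entry is, up to two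
terms, a sum of independent centred bounded variables. Hoeffding's inequality and a union bound
suffice; no matrix concentration is needed.

The Gram matrix of the embedding is treated directly, so no eigenvectors are compared and no gaps
among the leading eigenvalues are needed. The leading eigenvectors of `|A|` are eigenvectors of `A`
with positive eigenvalue, hence `⟨X̂ i, X̂ j⟩ = ⟨A eᵢ, T A eⱼ⟩` with `T` the inverse of `A`
truncated to them. In norm `T` differs from the pseudoinverse `P⁺` by at most `8 δ n / (l n)²`
(`bilin_close`), while `‖A eᵢ‖² ≤ n`; the factors `n` cancel and every single entry is controlled.
Moreover `⟨A eᵢ, P⁺ A eⱼ⟩ = ⟨Y i + wᵢ, Y j + wⱼ⟩` with `wᵢ = (Q* Q)⁻¹ Q* E eᵢ`, small because the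
rows of `E` average out against the positions. This is `IsASE.abs_inner_sub_inner_le`.

For (a), an error below half the gap `q - p` leaves a threshold that separates the subgraphs. The
rest is deterministic: a seed step loses no class and secures that of the processed vertex
(`SeedStep.represented`).

For (b), rank `R d` and dimensions at most `d` force every subgraph to span exactly `d` dimensions,
so the same estimate applies to it. By compactness a nearly correct Gram matrix comes from nearly
correct points, and Frobenius alignment is uniformly good because every latent value occurs often
(`IsAlignedLatent.exists_norm_sub_le`). Uniform continuity of the kernel concludes.

Given the positions, the edges are independent coins. All failure probabilities are at most `C n²
exp(-b n)`, which is eventually below every `n ^ (-c)`. -/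

/-! ### Perturbation of a Gram operator of finite rank. -/

section SpectralPerturbation

variable {H F : Type*} [NormedAddCommGroup H] [InnerProductSpace ℝ H]
  [NormedAddCommGroup F] [InnerProductSpace ℝ F]

/-- `A` is a symmetric perturbation of the Gram operator `Q Q*`, by an operator of norm at most `ε`,
where `Q* Q ≥ ρ`. The orthonormal basis `u` diagonalizes `B = |A|`, with decreasing eigenvalues
`lam`. -/
structure IsPerturbedGram {N : ℕ} (A B : H →ₗ[ℝ] H) (Q : F →ₗ[ℝ] H) (Qs : H →ₗ[ℝ] F) (ρ ε : ℝ)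
    (u : OrthonormalBasis (Fin N) ℝ H) (lam : Fin N → ℝ) : Prop where
  symm : ∀ x y, inner ℝ (A x) y = inner ℝ x (A y)
  symm_abs : ∀ x y, inner ℝ (B x) y = inner ℝ x (B y)
  abs_sq : ∀ x, B (B x) = A (A x)
  adjoint : ∀ v h, inner ℝ (Q v) h = inner ℝ v (Qs h)
  pos : 0 < ρ
  nonneg : 0 ≤ ε
  le_quarter : ε ≤ ρ / 4
  lower : ∀ v, ρ * ‖v‖ ^ 2 ≤ ‖Q v‖ ^ 2
  noise : ∀ h, ‖A h - Q (Qs h)‖ ≤ ε * ‖h‖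
  antitone : Antitone lam
  eigen : ∀ k, B (u k) = lam k • u k
  eigen_nonneg : ∀ k, 0 ≤ lam k

namespace IsPerturbedGram

variable {N : ℕ} {A B : H →ₗ[ℝ] H} {Q : F →ₗ[ℝ] H} {Qs : H →ₗ[ℝ] F} {ρ ε : ℝ}
  {u : OrthonormalBasis (Fin N) ℝ H} {lam : Fin N → ℝ}

theorem inner_abs (h : IsPerturbedGram A B Q Qs ρ ε u lam) (k : Fin N) (x : H) :
    inner ℝ (u k) (B x) = lam k * inner ℝ (u k) x := by
  rw [← h.symm_abs, h.eigen, inner_smul_left]; simp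

/-- Since `B² = A²`, the norms `‖A x‖` and `‖B x‖` agree. Thus the eigenvalues of `B = |A|` can be
estimated through `A`, before anything is known about eigenvectors of `A`. -/
theorem norm_sq (h : IsPerturbedGram A B Q Qs ρ ε u lam) (x : H) :
    ‖A x‖ ^ 2 = ∑ k, (lam k * inner ℝ (u k) x) ^ 2 := by
  have e : ‖A x‖ ^ 2 = ‖B x‖ ^ 2 := by
    rw [← real_inner_self_eq_norm_sq, ← real_inner_self_eq_norm_sq, h.symm, h.symm_abs, h.abs_sq]
  rw [e, ← u.sum_sq_norm_inner_right (B x)]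
  refine Finset.sum_congr rfl fun k _ => ?_
  rw [h.inner_abs, Real.norm_eq_abs, sq_abs]

theorem norm_sq_coord (u : OrthonormalBasis (Fin N) ℝ H) (x : H) :
    ‖x‖ ^ 2 = ∑ k, (inner ℝ (u k) x) ^ 2 := by
  rw [← u.sum_sq_norm_inner_right x]
  exact Finset.sum_congr rfl fun k _ => by rw [Real.norm_eq_abs, sq_abs]

theorem norm_sum_sq (u : OrthonormalBasis (Fin N) ℝ H) (c : Fin N → ℝ) :
    ‖∑ k, c k • u k‖ ^ 2 = ∑ k, c k ^ 2 := by
  rw [norm_sq_coord u]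
  refine Finset.sum_congr rfl fun k _ => ?_
  rw [Orthonormal.inner_right_fintype u.orthonormal]

/-- `‖Q* Q v‖ ≥ √ρ ‖Q v‖`, hence `Q Q*` is at least `ρ` on the range of `Q`. -/
theorem norm_range (h : IsPerturbedGram A B Q Qs ρ ε u lam) (v : F) :
    ρ * ‖Q v‖ ≤ ‖Q (Qs (Q v))‖ := by
  have h1 : ‖Q v‖ ^ 2 ≤ ‖v‖ * ‖Qs (Q v)‖ := by
    rw [← real_inner_self_eq_norm_sq, h.adjoint]
    exact real_inner_le_norm _ _
  have h2 := h.lower v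
  have h3 := h.lower (Qs (Q v))
  have hρ := h.pos
  have h4 : ρ * ‖Q v‖ ^ 2 ≤ ‖Qs (Q v)‖ ^ 2 := by
    by_cases hv : ‖Q v‖ = 0
    · rw [hv]; linarith [sq_nonneg ‖Qs (Q v)‖]
    have hv' : 0 < ‖Q v‖ := lt_of_le_of_ne (norm_nonneg _) (Ne.symm hv)
    have h5 : (‖Q v‖ ^ 2) ^ 2 ≤ ‖v‖ ^ 2 * ‖Qs (Q v)‖ ^ 2 := by
      rw [← mul_pow]; exact pow_le_pow_left₀ (by positivity) h1 2
    have h6 : ρ * (‖Q v‖ ^ 2) ^ 2 ≤ ‖Q v‖ ^ 2 * ‖Qs (Q v)‖ ^ 2 := by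
      calc ρ * (‖Q v‖ ^ 2) ^ 2 ≤ ρ * (‖v‖ ^ 2 * ‖Qs (Q v)‖ ^ 2) := by gcongr
        _ = (ρ * ‖v‖ ^ 2) * ‖Qs (Q v)‖ ^ 2 := by ring
        _ ≤ _ := by gcongr
    have h7 : 0 < ‖Q v‖ ^ 2 := by positivity
    nlinarith
  refine le_of_sq_le_sq ?_ (norm_nonneg _)
  calc (ρ * ‖Q v‖) ^ 2 = ρ * (ρ * ‖Q v‖ ^ 2) := by ring
    _ ≤ ρ * ‖Qs (Q v)‖ ^ 2 := by gcongr
    _ ≤ _ := h3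

theorem injective (h : IsPerturbedGram A B Q Qs ρ ε u lam) {v : F} (hv : Q v = 0) : v = 0 := by
  have h1 := h.lower v
  have hρ := h.pos
  rw [hv, norm_zero] at h1
  have : ‖v‖ ^ 2 ≤ 0 := by
    by_contra hc
    push Not at hc
    nlinarith [mul_pos hρ hc]
  simpa using le_antisymm this (by positivity)

variable [FiniteDimensional ℝ F]

/-- Lower bound for the leading eigenvalues. -/
theorem le_eigenvalue (h : IsPerturbedGram A B Q Qs ρ ε u lam) (k : Fin N)
    (hk : (k : ℕ) < Module.finrank ℝ F) : ρ / 2 ≤ lam k := by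
  -- Courant–Fischer: as `k < dim F`, some `Q v ≠ 0` is orthogonal to the first `k` eigenvectors.
  -- There `‖A (Q v)‖ ≤ lam k ‖Q v‖`, while `Q Q*` expands by at least `ρ`, so `lam k ≥ ρ - ε`.
  let f : F →ₗ[ℝ] (Fin k → ℝ) := LinearMap.pi fun j =>
    (innerₗ H (u (Fin.castLE k.2.le j))).comp Q
  have hker : LinearMap.ker f ≠ ⊥ := f.ker_ne_bot_of_finrank_lt (by simpa using hk)
  obtain ⟨v, hv, hv0⟩ := (Submodule.ne_bot_iff _).1 hker
  have hQ : Q v ≠ 0 := fun h0 => hv0 (h.injective h0)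
  have hcoord : ∀ j, j < k → inner ℝ (u j) (Q v) = (0 : ℝ) := fun j hj => by
    have := congrFun (LinearMap.mem_ker.1 hv) ⟨j, hj⟩
    simpa [f] using this
  have h1 : ‖A (Q v)‖ ^ 2 ≤ (lam k * ‖Q v‖) ^ 2 := by
    rw [h.norm_sq, mul_pow, norm_sq_coord u, Finset.mul_sum]
    refine Finset.sum_le_sum fun j _ => ?_
    rcases lt_or_ge j k with hj | hj
    · simp [hcoord j hj]
    · rw [mul_pow]
      gcongr
      · exact h.eigen_nonneg j
      · exact h.antitone hj
  have h2 : ‖A (Q v)‖ ≤ lam k * ‖Q v‖ :=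
    le_of_sq_le_sq h1 (mul_nonneg (h.eigen_nonneg k) (norm_nonneg _))
  have h3 := h.norm_range v
  have h4 := h.noise (Q v)
  have h5 : ‖Q (Qs (Q v))‖ ≤ ‖A (Q v)‖ + ‖A (Q v) - Q (Qs (Q v))‖ := by
    have := norm_sub_le (A (Q v)) (A (Q v) - Q (Qs (Q v)))
    simpa using this
  have h6 : 0 < ‖Q v‖ := norm_pos_iff.2 hQ
  have h7 : ρ * ‖Q v‖ ≤ (lam k + ε) * ‖Q v‖ := by linarith
  have h8 := le_of_mul_le_mul_right h7 h6
  linarith [h.le_quarter, h.pos]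

/-- Upper bound for the other eigenvalues. -/
theorem eigenvalue_le [FiniteDimensional ℝ H] (h : IsPerturbedGram A B Q Qs ρ ε u lam) (k : Fin N)
    (hk : Module.finrank ℝ F ≤ k) : lam k ≤ ε := by
  -- Since `dim F + (N - 1 - k) < N`, some nonzero `v` lies in `ker Q*` and is orthogonal to all `u
  -- j` with `j > k`. On `ker Q*` the operator `A` is pure noise.
  let f : H →ₗ[ℝ] F × ({j : Fin N // k < j} → ℝ) := Qs.prod (LinearMap.pi fun j =>
    innerₗ H (u j))
  have hcard : Fintype.card {j : Fin N // k < j} = N - 1 - k := by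
    rw [Fintype.card_subtype, Finset.filter_lt_eq_Ioi]; simp
  have hH : Module.finrank ℝ H = N := by
    simpa using Module.finrank_eq_card_basis u.toBasis
  have hker : LinearMap.ker f ≠ ⊥ := f.ker_ne_bot_of_finrank_lt (by
    rw [Module.finrank_prod, Module.finrank_fintype_fun_eq_card, hcard, hH]
    have := k.2
    omega)
  obtain ⟨v, hv, hv0⟩ := (Submodule.ne_bot_iff _).1 hker
  have hv' := LinearMap.mem_ker.1 hv
  have hQs : Qs v = 0 := congrArg Prod.fst hv'
  have hcoord : ∀ j, k < j → inner ℝ (u j) v = (0 : ℝ) := fun j hj => by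
    have := congrFun (congrArg Prod.snd hv') ⟨j, hj⟩
    simpa [f] using this
  have h1 : (lam k * ‖v‖) ^ 2 ≤ ‖A v‖ ^ 2 := by
    rw [h.norm_sq, mul_pow, norm_sq_coord u, Finset.mul_sum]
    refine Finset.sum_le_sum fun j _ => ?_
    rcases lt_or_ge k j with hj | hj
    · simp [hcoord j hj]
    · rw [mul_pow]
      gcongr
      · exact h.eigen_nonneg k
      · exact h.antitone hj
  have h2 : lam k * ‖v‖ ≤ ‖A v‖ := le_of_sq_le_sq h1 (norm_nonneg _)
  have h4 := h.noise v
  rw [hQs, map_zero, sub_zero] at h4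
  exact le_of_mul_le_mul_right (h2.trans h4) (norm_pos_iff.2 hv0)

/-- The leading eigenvectors of `|A|` are eigenvectors of `A`. -/
theorem eigen_leading (h : IsPerturbedGram A B Q Qs ρ ε u lam) (k : Fin N)
    (hk : (k : ℕ) < Module.finrank ℝ F) : A (u k) = lam k • u k := by
  have hl := h.le_eigenvalue k hk
  have hρ := h.pos
  have hAA : A (A (u k)) = (lam k) • (lam k) • u k := by
    rw [← h.abs_sq, h.eigen, map_smul, h.eigen]
  -- `(A + lam k) w = (A² - lam k²) (u k) = 0`, so a nonzero `w` would have eigenvalue `-lam k ≤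
  -- -ρ/2`. But `A ≥ Q Q* - ε ≥ -ε` with `ε ≤ ρ/4`.
  set w := A (u k) - lam k • u k with hw
  have hAw : A w = -(lam k • w) := by
    rw [hw, map_sub, hAA, map_smul, smul_sub]; abel
  have h1 : inner ℝ w (A w) = -(lam k * ‖w‖ ^ 2) := by
    rw [hAw, inner_neg_right, inner_smul_right, real_inner_self_eq_norm_sq]
  have h2 : inner ℝ w (A w) = ‖Qs w‖ ^ 2 + inner ℝ w (A w - Q (Qs w)) := by
    rw [inner_sub_right, real_inner_comm (Q (Qs w)) w, h.adjoint, real_inner_self_eq_norm_sq]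
    ring
  have h3 : -(‖w‖ * (ε * ‖w‖)) ≤ inner ℝ w (A w - Q (Qs w)) := by
    have h5 := neg_le_of_abs_le (abs_real_inner_le_norm w (A w - Q (Qs w)))
    have h6 := mul_le_mul_of_nonneg_left (h.noise w) (norm_nonneg w)
    linarith
  have hw0 : w = 0 := by
    by_contra hne
    have hpos : 0 < ‖w‖ ^ 2 := by have := norm_pos_iff.2 hne; positivity
    nlinarith [sq_nonneg ‖Qs w‖, h.le_quarter]
  exact sub_eq_zero.1 hw0

/-- This inverts `Q* Q`: injectivity is enough in finite dimension, and the bound is Cauchy–Schwarz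
in `ρ ‖v‖² ≤ ‖Q v‖² = ⟨v, z⟩`. -/
theorem exists_preimage (h : IsPerturbedGram A B Q Qs ρ ε u lam) (z : F) :
    ∃ v, Qs (Q v) = z ∧ ρ * ‖v‖ ≤ ‖z‖ := by
  have hρ := h.pos
  have hinj : Function.Injective (Qs ∘ₗ Q) := by
    rw [← LinearMap.ker_eq_bot, Submodule.eq_bot_iff]
    intro v hv
    have hv' : Qs (Q v) = 0 := hv
    have : ‖Q v‖ ^ 2 = 0 := by
      rw [← real_inner_self_eq_norm_sq, h.adjoint, hv', inner_zero_right]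
    exact h.injective (by simpa using this)
  obtain ⟨v, hv⟩ := LinearMap.injective_iff_surjective.1 hinj z
  have hv' : Qs (Q v) = z := hv
  refine ⟨v, hv', ?_⟩
  have h1 : ‖Q v‖ ^ 2 ≤ ‖v‖ * ‖z‖ := by
    rw [← real_inner_self_eq_norm_sq, h.adjoint, hv']
    exact real_inner_le_norm _ _
  have h2 := h.lower v
  rcases (norm_nonneg v).eq_or_lt with h0 | h0
  · rw [← h0]; simp
  · nlinarith

theorem eigen_leading_inner (h : IsPerturbedGram A B Q Qs ρ ε u lam) (k : Fin N)
    (hk : (k : ℕ) < Module.finrank ℝ F) (x : H) :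
    inner ℝ (u k) (A x) = lam k * inner ℝ (u k) x := by
  rw [← h.symm, h.eigen_leading k hk, inner_smul_left]; simp

/-- Truncated inverse of `A`, applied to `a`. -/
theorem exists_inverse_leading [FiniteDimensional ℝ H] (h : IsPerturbedGram A B Q Qs ρ ε u lam) (a : H) :
    ∃ t t' : H, t = A t' ∧ ‖t‖ ≤ 2 / ρ * ‖a‖ ∧ ‖t'‖ ≤ (2 / ρ) ^ 2 * ‖a‖ ∧
      ‖a - A t‖ ≤ ‖a‖ ∧ ‖A (a - A t)‖ ≤ ε * ‖a‖ ∧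
      ∀ b, inner ℝ t b = ∑ k : Fin N, if (k : ℕ) < Module.finrank ℝ F then
        (lam k)⁻¹ * inner ℝ (u k) a * inner ℝ (u k) b else 0 := by
  have hρ := h.pos
  set m := Module.finrank ℝ F
  set c : Fin N → ℝ := fun k => inner ℝ (u k) a
  have ha : a = ∑ k, c k • u k := (u.sum_repr' a).symm
  have hinv : ∀ k : Fin N, (k : ℕ) < m → 0 < lam k ∧ (lam k)⁻¹ ≤ 2 / ρ := fun k hk => by
    have h1 := h.le_eigenvalue k hk
    have h2 : 0 < lam k := by linarith
    refine ⟨h2, ?_⟩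
    rw [inv_le_comm₀ h2 (by positivity), inv_div]; exact h1
  have hbound : ∀ (e : Fin N → ℝ) (s : ℝ), 0 ≤ s → (∀ k, |e k| ≤ s * |c k|) →
      ‖∑ k, e k • u k‖ ≤ s * ‖a‖ := fun e s hs he => by
    refine le_of_sq_le_sq ?_ (by positivity)
    rw [norm_sum_sq, mul_pow, norm_sq_coord u a, Finset.mul_sum]
    refine Finset.sum_le_sum fun k _ => ?_
    rw [← mul_pow, ← sq_abs (e k)]
    refine (pow_le_pow_left₀ (abs_nonneg _) (he k) 2).trans (le_of_eq ?_)
    rw [mul_pow, sq_abs, mul_pow]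
  -- With `T` the truncated inverse, `t = T a` and `t' = T² a`; then `a - A t` is the projection of
  -- `a` to the remaining eigenvectors.
  set t : H := ∑ k : Fin N, (if (k : ℕ) < m then (lam k)⁻¹ * c k else 0) • u k with ht
  set t' : H := ∑ k : Fin N, (if (k : ℕ) < m then (lam k)⁻¹ * ((lam k)⁻¹ * c k) else 0) • u k with ht'
  have hAt' : A t' = t := by
    rw [ht', map_sum, ht]
    refine Finset.sum_congr rfl fun k _ => ?_
    split_ifs with hk
    · rw [map_smul, h.eigen_leading k hk, smul_smul]
      congr 1
      have := (hinv k hk).1.ne'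
      field_simp
    · simp
  have hAt : A t = ∑ k : Fin N, (if (k : ℕ) < m then c k else 0) • u k := by
    rw [ht, map_sum]
    refine Finset.sum_congr rfl fun k _ => ?_
    split_ifs with hk
    · rw [map_smul, h.eigen_leading k hk, smul_smul]
      congr 1
      have := (hinv k hk).1.ne'
      field_simp
    · simp
  have hr : a - A t = ∑ k : Fin N, (if (k : ℕ) < m then 0 else c k) • u k := by
    rw [hAt]
    nth_rewrite 1 [ha]
    rw [← Finset.sum_sub_distrib]
    refine Finset.sum_congr rfl fun k _ => ?_
    split_ifs <;> simp
  refine ⟨t, t', hAt'.symm, hbound _ _ (by positivity) fun k => ?_,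
    hbound _ _ (by positivity) fun k => ?_, ?_, ?_, fun b => ?_⟩
  · split_ifs with hk
    · rw [abs_mul, abs_of_pos (inv_pos.2 (hinv k hk).1)]
      gcongr
      exact (hinv k hk).2
    · rw [abs_zero]; positivity
  · split_ifs with hk
    · rw [abs_mul, abs_mul, abs_of_pos (inv_pos.2 (hinv k hk).1), ← mul_assoc, pow_two]
      gcongr
      · exact (inv_pos.2 (hinv k hk).1).le
      · exact (hinv k hk).2
      · exact (hinv k hk).2
    · rw [abs_zero]; positivity
  · rw [hr]
    have := hbound (fun k => if (k : ℕ) < m then 0 else c k) 1 zero_le_one fun k => by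
      split_ifs <;> simp
    simpa using this
  · refine le_of_sq_le_sq ?_ (mul_nonneg h.nonneg (norm_nonneg _))
    -- The trailing `u k` are eigenvectors of `|A|` only, so the norm is computed through `|A|`.
    rw [h.norm_sq, mul_pow, norm_sq_coord u a, Finset.mul_sum]
    refine Finset.sum_le_sum fun k _ => ?_
    rw [hr, Orthonormal.inner_right_fintype u.orthonormal]
    split_ifs with hk
    · rw [mul_zero, zero_pow two_ne_zero]
      positivity
    · rw [mul_pow]
      gcongr
      · exact h.eigen_nonneg k
      · exact h.eigenvalue_le k (not_lt.1 hk)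
  · rw [ht, sum_inner]
    refine Finset.sum_congr rfl fun k _ => ?_
    rw [inner_smul_left]
    split_ifs <;> simp [c]

/-- The truncated inverse of `A` is close to the pseudoinverse of `Q Q*`, which maps `b` to
`Q v` where `Q* Q Q* Q v = Q* b`. -/
theorem bilin_close [FiniteDimensional ℝ H] (h : IsPerturbedGram A B Q Qs ρ ε u lam) (a b : H) (v : F)
    (hv : Qs (Q (Qs (Q v))) = Qs b) :
    |(∑ k : Fin N, if (k : ℕ) < Module.finrank ℝ F then
        (lam k)⁻¹ * inner ℝ (u k) a * inner ℝ (u k) b else 0) - inner ℝ a (Q v)| ≤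
      8 * ε / ρ ^ 2 * (‖a‖ * ‖b‖) := by
  have hρ := h.pos
  have hε := h.nonneg
  obtain ⟨t, t', htA, ht, ht', hr, hAr, hin⟩ := h.exists_inverse_leading a
  obtain ⟨w, hw, -⟩ := h.exists_preimage v
  rw [← hin b]
  set g := Q v with hg
  -- With `P = Q Q*`: `g = P⁺ b`, and `w = (Q* Q)⁻¹ v` gives `P g' = g`.
  set g' := Q w with hg'
  have hPg' : Q (Qs g') = g := by rw [hg', hw]
  have horth : ∀ z, inner ℝ (Q z) (b - Q (Qs g)) = 0 := fun z => by
    rw [h.adjoint, map_sub, hv, sub_self, inner_zero_right]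
  have hpyth : ‖b‖ ^ 2 = ‖Q (Qs g)‖ ^ 2 + ‖b - Q (Qs g)‖ ^ 2 := by
    have e : b = Q (Qs g) + (b - Q (Qs g)) := by abel
    nth_rewrite 1 [e]
    rw [norm_add_sq_real, horth]; ring
  have hb1 : ‖Q (Qs g)‖ ≤ ‖b‖ :=
    le_of_sq_le_sq (by nlinarith [sq_nonneg ‖b - Q (Qs g)‖]) (norm_nonneg _)
  have hb2 : ‖b - Q (Qs g)‖ ≤ ‖b‖ :=
    le_of_sq_le_sq (by nlinarith [sq_nonneg ‖Q (Qs g)‖]) (norm_nonneg _)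
  have hgn : ‖g‖ ≤ 1 / ρ * ‖b‖ := by
    have := (h.norm_range v).trans hb1
    rw [one_div, ← div_eq_inv_mul, le_div_iff₀ hρ]; linarith
  have hgn' : ‖g'‖ ≤ (1 / ρ) ^ 2 * ‖b‖ := by
    have h1 := h.norm_range w
    rw [← hg', hPg'] at h1
    have h2 : ‖g'‖ ≤ 1 / ρ * ‖g‖ := by
      rw [one_div, ← div_eq_inv_mul, le_div_iff₀ hρ]; linarith
    calc ‖g'‖ ≤ 1 / ρ * (1 / ρ * ‖b‖) := h2.trans (by gcongr)
      _ = _ := by ring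
  -- Expand into `⟨t, b - P g⟩ - ⟨t, (A - P) g⟩ - ⟨a - A t, g⟩`. In the first term `t = A t'` and `b
  -- - P g` is orthogonal to the range of `Q`, so `A` may be replaced by `A - P`; in the last one `g
  -- = P g'`. Each resulting term carries one factor `ε`, with constants `4 + 2 + 1 + 1 = 8`.
  have hid : inner ℝ t b - inner ℝ a g =
      inner ℝ (A t' - Q (Qs t')) (b - Q (Qs g)) - inner ℝ t (A g - Q (Qs g))
        - (inner ℝ (A (a - A t)) g' - inner ℝ (a - A t) (A g' - Q (Qs g'))) := by
    have e1 : inner ℝ (A t' - Q (Qs t')) (b - Q (Qs g)) = inner ℝ t (b - Q (Qs g)) := by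
      rw [inner_sub_left, horth, sub_zero, htA]
    rw [e1, h.symm, hPg', inner_sub_right t, inner_sub_right t, inner_sub_right (a - A t),
      inner_sub_left a (A t) g, ← h.symm t g]
    ring
  rw [hid]
  have b1 : |inner ℝ (A t' - Q (Qs t')) (b - Q (Qs g))| ≤
      ε * ((2 / ρ) ^ 2 * ‖a‖) * ‖b‖ :=
    (abs_real_inner_le_norm _ _).trans
      (mul_le_mul ((h.noise t').trans (by gcongr)) hb2 (norm_nonneg _) (by positivity))
  have b2 : |inner ℝ t (A g - Q (Qs g))| ≤ (2 / ρ * ‖a‖) * (ε * (1 / ρ * ‖b‖)) :=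
    (abs_real_inner_le_norm _ _).trans
      (mul_le_mul ht ((h.noise g).trans (by gcongr)) (norm_nonneg _) (by positivity))
  have b3 : |inner ℝ (A (a - A t)) g'| ≤ (ε * ‖a‖) * ((1 / ρ) ^ 2 * ‖b‖) :=
    (abs_real_inner_le_norm _ _).trans
      (mul_le_mul hAr hgn' (norm_nonneg _) (by positivity))
  have b4 : |inner ℝ (a - A t) (A g' - Q (Qs g'))| ≤ ‖a‖ * (ε * ((1 / ρ) ^ 2 * ‖b‖)) :=
    (abs_real_inner_le_norm _ _).trans
      (mul_le_mul hr ((h.noise g').trans (by gcongr)) (norm_nonneg _) (by positivity))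
  have htot : 8 * ε / ρ ^ 2 * (‖a‖ * ‖b‖) = ε * ((2 / ρ) ^ 2 * ‖a‖) * ‖b‖ +
      (2 / ρ * ‖a‖) * (ε * (1 / ρ * ‖b‖)) + ((ε * ‖a‖) * ((1 / ρ) ^ 2 * ‖b‖) +
      ‖a‖ * (ε * ((1 / ρ) ^ 2 * ‖b‖))) := by
    field_simp; ring
  rw [htot]
  exact (abs_sub _ _).trans (add_le_add ((abs_sub _ _).trans (add_le_add b1 b2))
    ((abs_sub _ _).trans (add_le_add b3 b4)))

end IsPerturbedGram

end SpectralPerturbation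

/-! ### Entrywise recovery of a Gram matrix by spectral embedding. -/

section GramEmbedding

variable {V F : Type*} [Fintype V] [NormedAddCommGroup F] [InnerProductSpace ℝ F]

/-- The map `v ↦ (⟨Y i, v⟩)ᵢ`. -/
noncomputable def analysisMap {V : Type*} (Y : V → F) : F →ₗ[ℝ] EuclideanSpace ℝ V where
  toFun v := WithLp.toLp 2 fun i => inner ℝ (Y i) v
  map_add' v w := by ext i; simp [inner_add_right]
  map_smul' c v := by ext i; simp [inner_smul_right]

/-- The map `h ↦ ∑ᵢ hᵢ Y i`. -/
noncomputable def synthesisMap (Y : V → F) : EuclideanSpace ℝ V →ₗ[ℝ] F where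
  toFun h := ∑ i, h i • Y i
  map_add' v w := by simp [add_smul, Finset.sum_add_distrib]
  map_smul' c v := by simp [mul_smul, Finset.smul_sum]

theorem analysisMap_apply {V : Type*} (Y : V → F) (v : F) (i : V) :
    analysisMap Y v i = inner ℝ (Y i) v := rfl

theorem synthesisMap_apply (Y : V → F) (h : EuclideanSpace ℝ V) :
    synthesisMap Y h = ∑ i, h i • Y i := rfl

theorem inner_analysisMap (Y : V → F) (v : F) (h : EuclideanSpace ℝ V) :
    inner ℝ (analysisMap Y v) h = inner ℝ v (synthesisMap Y h) := by
  simp only [PiLp.inner_apply, analysisMap_apply, synthesisMap_apply, inner_sum, inner_smul_right]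
  refine Finset.sum_congr rfl fun i _ => ?_
  rw [real_inner_comm v]; simp

variable [DecidableEq V]

theorem toEuclideanLin_apply_coord (A : Matrix V V ℝ) (h : EuclideanSpace ℝ V) (i : V) :
    Matrix.toEuclideanLin A h i = ∑ j, A i j * h j := by
  simp [Matrix.toEuclideanLin, Matrix.mulVec, dotProduct]

theorem inner_toEuclideanLin_of_transpose_eq {A : Matrix V V ℝ} (hA : A.transpose = A)
    (x y : EuclideanSpace ℝ V) :
    inner ℝ (Matrix.toEuclideanLin A x) y = inner ℝ x (Matrix.toEuclideanLin A y) := by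
  simp only [PiLp.inner_apply, toEuclideanLin_apply_coord, RCLike.inner_apply, conj_trivial,
    Finset.mul_sum, Finset.sum_mul]
  rw [Finset.sum_comm]
  refine Finset.sum_congr rfl fun i _ => Finset.sum_congr rfl fun j _ => ?_
  have : A j i = A i j := congrFun (congrFun hA i) j
  rw [this]; ring

/-- The adjacency spectral embedding of a symmetric matrix close to the Gram matrix of `Y`
recovers the Gram matrix of `Y`, entrywise. -/
theorem IsASE.abs_inner_sub_inner_le [FiniteDimensional ℝ F] {m : ℕ}
    (hm : Module.finrank ℝ F = m) {A : Matrix V V ℝ} (hA : A.transpose = A) (Y : V → F)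
    {n l δ : ℝ} (hn : 0 < n) (hl : 0 < l) (hδ : 0 ≤ δ) (hδl : δ ≤ l / 4)
    (hlow : ∀ v : F, l * n * ‖v‖ ^ 2 ≤ ∑ i, inner ℝ (Y i) v ^ 2) (hY : ∀ i, ‖Y i‖ ≤ 1)
    (hrow : ∀ i, ∑ j, A i j ^ 2 ≤ n)
    (hop : ∀ h : EuclideanSpace ℝ V,
      ∑ i, (∑ j, (A i j - inner ℝ (Y i) (Y j)) * h j) ^ 2 ≤ (δ * n * ‖h‖) ^ 2)
    (hdev : ∀ i, ‖∑ j, (A i j - inner ℝ (Y i) (Y j)) • Y j‖ ≤ δ * n)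
    {Xhat : V → EuclideanSpace ℝ (Fin m)} (hX : IsASE A Xhat) (i j : V) :
    |inner ℝ (Xhat i) (Xhat j) - inner ℝ (Y i) (Y j)| ≤ (8 / l ^ 2 + 3 / l) * δ := by
  obtain ⟨B, u, lam, hB, hBB, hanti, hu, hX⟩ := hX
  have hBt : B.transpose = B := by
    have := hB.1
    rwa [Matrix.IsHermitian, Matrix.conjTranspose_eq_transpose_of_trivial] at this
  set La := Matrix.toEuclideanLin A with hLa
  set Lb := Matrix.toEuclideanLin B with hLb
  have hsymA := inner_toEuclideanLin_of_transpose_eq hA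
  have hsymB := inner_toEuclideanLin_of_transpose_eq hBt
  have hmul : ∀ (C D : Matrix V V ℝ) (x : EuclideanSpace ℝ V),
      Matrix.toEuclideanLin C (Matrix.toEuclideanLin D x) = Matrix.toEuclideanLin (C * D) x := by
    intro C D x
    ext k
    simp [Matrix.toEuclideanLin, Matrix.mulVec_mulVec]
  have hLacol : ∀ i k, La (EuclideanSpace.single i 1) k = A k i := fun i k => by
    rw [hLa, toEuclideanLin_apply_coord]; simp
  have hAsymm : ∀ i j, A j i = A i j := fun i j => congrFun (congrFun hA i) j
  have key : IsPerturbedGram La Lb (analysisMap Y) (synthesisMap Y) (l * n) (δ * n) u lam := by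
    refine ⟨hsymA, hsymB, fun x => ?_, inner_analysisMap Y, by positivity, by positivity,
      by nlinarith, fun v => ?_, fun h => ?_, hanti, hu, fun k => ?_⟩
    · rw [hLa, hLb, hmul, hmul, hBB, hA]
    · refine (hlow v).trans (le_of_eq ?_)
      rw [EuclideanSpace.norm_sq_eq]
      simp [analysisMap_apply]
    · refine le_of_sq_le_sq (le_trans (le_of_eq ?_) (hop h)) (by positivity)
      rw [EuclideanSpace.norm_sq_eq]
      refine Finset.sum_congr rfl fun k _ => ?_
      rw [Real.norm_eq_abs, sq_abs, PiLp.sub_apply, hLa, toEuclideanLin_apply_coord,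
        analysisMap_apply, synthesisMap_apply, inner_sum, ← Finset.sum_sub_distrib]
      congr 1
      refine Finset.sum_congr rfl fun j _ => ?_
      rw [inner_smul_right]; ring
    · have h1 : 0 ≤ inner ℝ (u k) (Lb (u k)) := by
        have := hB.dotProduct_mulVec_nonneg (u k).ofLp
        simpa [PiLp.inner_apply, hLb, Matrix.toEuclideanLin, dotProduct, mul_comm] using this
      rw [hLb, hu k, inner_smul_right, real_inner_self_eq_norm_sq, u.orthonormal.1 k] at h1
      simpa using h1
  -- Hence none of the `m` columns of the embedding takes the default value zero.
  have hcard : m ≤ Fintype.card V := by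
    have h1 := LinearMap.finrank_le_finrank_of_injective (f := analysisMap Y) (by
      rw [← LinearMap.ker_eq_bot, Submodule.eq_bot_iff]
      exact fun v hv => key.injective hv)
    rwa [hm, finrank_euclideanSpace] at h1
  have hnorm : ∀ i, ‖La (EuclideanSpace.single i 1)‖ ^ 2 ≤ n := fun i => by
    refine le_trans (le_of_eq ?_) (hrow i)
    rw [EuclideanSpace.norm_sq_eq]
    exact Finset.sum_congr rfl fun k _ => by rw [hLacol, Real.norm_eq_abs, sq_abs, hAsymm]
  -- Column `i` of the Gram matrix is `Q (Y i)`, so `w = (Q* Q)⁻¹ Q* (A eᵢ - Q (Y i))`; its norm is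
  -- at most `δ n / (l n)`.
  have hpre : ∀ i, ∃ w : F, ‖w‖ ≤ δ / l ∧
      synthesisMap Y (analysisMap Y (Y i + w)) = synthesisMap Y (La (EuclideanSpace.single i 1)) := by
    intro i
    obtain ⟨w, hw, hw'⟩ := key.exists_preimage (∑ j, (A i j - inner ℝ (Y i) (Y j)) • Y j)
    refine ⟨w, ?_, ?_⟩
    · have h1 := hw'.trans (hdev i)
      rw [le_div_iff₀ hl]
      have : n * (‖w‖ * l) ≤ n * δ := by linarith
      exact le_of_mul_le_mul_left this hn
    · rw [map_add, map_add, hw, synthesisMap_apply, synthesisMap_apply, ← Finset.sum_add_distrib]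
      refine Finset.sum_congr rfl fun k _ => ?_
      rw [hLacol, analysisMap_apply, ← add_smul, real_inner_comm, hAsymm]
      congr 1; ring
  obtain ⟨wi, hwi, hi⟩ := hpre i
  obtain ⟨wj, hwj, hj⟩ := hpre j
  obtain ⟨v, hv, -⟩ := key.exists_preimage (Y j + wj)
  have hmain := key.bilin_close (La (EuclideanSpace.single i 1)) (La (EuclideanSpace.single j 1)) v
    (by rw [hv, hj])
  have hgram : inner ℝ (La (EuclideanSpace.single i 1)) (analysisMap Y v) =
      inner ℝ (Y i + wi) (Y j + wj) := by
    rw [real_inner_comm, inner_analysisMap, ← hi, ← inner_analysisMap, real_inner_comm,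
      inner_analysisMap, hv]
  -- As `⟨u k, A eᵢ⟩ = lam k * u k i`, the weights `(lam k)⁻¹` turn into `lam k`, the squares of the
  -- scalings in the embedding.
  have hsum : (∑ k : Fin (Fintype.card V), if (k : ℕ) < Module.finrank ℝ F then
      (lam k)⁻¹ * inner ℝ (u k) (La (EuclideanSpace.single i 1)) *
        inner ℝ (u k) (La (EuclideanSpace.single j 1)) else 0) = inner ℝ (Xhat i) (Xhat j) := by
    have h1 : ∀ k : Fin (Fintype.card V), (if (k : ℕ) < Module.finrank ℝ F then
      (lam k)⁻¹ * inner ℝ (u k) (La (EuclideanSpace.single i 1)) *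
        inner ℝ (u k) (La (EuclideanSpace.single j 1)) else 0) =
        if (k : ℕ) < m then lam k * (u k i * u k j) else 0 := fun k => by
      rw [hm]
      split_ifs with hk
      · have hk' : (k : ℕ) < Module.finrank ℝ F := by rwa [hm]
        have hpos : lam k ≠ 0 := by
          have := key.le_eigenvalue k hk'
          have : 0 < l * n := by positivity
          linarith
        rw [key.eigen_leading_inner k hk', key.eigen_leading_inner k hk',
          EuclideanSpace.inner_single_right, EuclideanSpace.inner_single_right]
        simp only [conj_trivial, one_mul]
        field_simp
      · rfl
    rw [Finset.sum_congr rfl fun k _ => h1 k, ← Finset.sum_filter]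
    rw [PiLp.inner_apply]
    symm
    refine Finset.sum_bij (fun a _ => Fin.castLE hcard a) (fun a _ => by simp)
      (fun a _ b _ hab => by simpa using hab) (fun b hb => ?_) (fun a _ => ?_)
    · have hb' : (b : ℕ) < m := by simpa using hb
      exact ⟨⟨b, hb'⟩, Finset.mem_univ _, rfl⟩
    · have ha : (a : ℕ) < Fintype.card V := lt_of_lt_of_le a.2 hcard
      rw [hX, hX, dif_pos ha, dif_pos ha, RCLike.inner_apply, conj_trivial]
      have hpos : 0 ≤ lam ⟨a, ha⟩ := key.eigen_nonneg _
      have hs := Real.mul_self_sqrt hpos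
      change _ = lam ⟨a, ha⟩ * (u ⟨a, ha⟩ i * u ⟨a, ha⟩ j)
      linear_combination u ⟨a, ha⟩ i * u ⟨a, ha⟩ j * hs
  rw [hsum, hgram] at hmain
  -- This factor `n` cancels against `8 (δ n) / (l n)²`.
  have hnn : ‖La (EuclideanSpace.single i 1)‖ * ‖La (EuclideanSpace.single j 1)‖ ≤ n := by
    nlinarith [hnorm i, hnorm j,
      sq_nonneg (‖La (EuclideanSpace.single i 1)‖ - ‖La (EuclideanSpace.single j 1)‖)]
  have h1 : |inner ℝ (Xhat i) (Xhat j) - inner ℝ (Y i + wi) (Y j + wj)| ≤ 8 / l ^ 2 * δ := by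
    refine hmain.trans ((mul_le_mul_of_nonneg_left hnn (by positivity)).trans (le_of_eq ?_))
    field_simp
  -- Two linear terms and a quadratic one, each at most `δ / l`; the quadratic one because `δ / l ≤
  -- 1`.
  have h2 : |inner ℝ (Y i + wi) (Y j + wj) - inner ℝ (Y i) (Y j)| ≤ 3 / l * δ := by
    have e : inner ℝ (Y i + wi) (Y j + wj) - inner ℝ (Y i) (Y j) =
        inner ℝ (Y i) wj + inner ℝ wi (Y j) + inner ℝ wi wj := by
      simp only [inner_add_left, inner_add_right]; ring
    have hdl : δ / l ≤ 1 := by rw [div_le_one hl]; linarith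
    have hdl0 : 0 ≤ δ / l := by positivity
    have b1 : |inner ℝ (Y i) wj| ≤ 1 * (δ / l) := (abs_real_inner_le_norm _ _).trans
      (mul_le_mul (hY i) hwj (norm_nonneg _) zero_le_one)
    have b2 : |inner ℝ wi (Y j)| ≤ (δ / l) * 1 := (abs_real_inner_le_norm _ _).trans
      (mul_le_mul hwi (hY j) (norm_nonneg _) hdl0)
    have b3 : |inner ℝ wi wj| ≤ 1 * (δ / l) := (abs_real_inner_le_norm _ _).trans
      (mul_le_mul (hwi.trans hdl) hwj (norm_nonneg _) zero_le_one)
    rw [e]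
    refine ((abs_add_le _ _).trans (add_le_add (abs_add_le _ _) le_rfl)).trans ?_
    have : 3 / l * δ = 3 * (δ / l) := by ring
    linarith
  have := abs_sub_le (inner ℝ (Xhat i) (Xhat j)) (inner ℝ (Y i + wi) (Y j + wj))
    (inner ℝ (Y i) (Y j))
  rw [add_mul]
  linarith

end GramEmbedding

/-! ### Deterministic analysis of the seed selection. -/

section Seeds

/-- The threshold `t` separates the inner products inside the classes of `cl` from those between
different classes. -/
def SeparatesClasses {V C E : Type*} [NormedAddCommGroup E] [InnerProductSpace ℝ E] (Xhat : V → E)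
    (cl : V → C) (t : ℝ) : Prop :=
  (∀ i j, cl i = cl j → t < inner ℝ (Xhat i) (Xhat j)) ∧
    ∀ i j, cl i ≠ cl j → inner ℝ (Xhat i) (Xhat j) < t

variable {R n D : ℕ} {Xhat : Fin n → EuclideanSpace ℝ (Fin D)} {cl : Fin n → Fin R} {t : ℝ}

/-- Pigeonhole: pairwise products below the threshold put the seeds into different classes, and
there are as many seeds as classes. -/
theorem SeparatesClasses.surjective_of_forall_lt (h : SeparatesClasses Xhat cl t)
    {s : Fin R → Fin n}
    (hs : ∀ y z, y ≠ z → inner ℝ (Xhat (s y)) (Xhat (s z)) < t) :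
    Function.Surjective (cl ∘ s) := by
  refine Finite.injective_iff_surjective.1 fun y z hyz => ?_
  by_contra hne
  exact lt_asymm (hs y z hne) (h.1 _ _ hyz)

/-- A seed step keeps the classes that are represented, and afterwards the class of the vertex it
has processed is represented. -/
theorem SeedStep.represented (h : SeparatesClasses Xhat cl t) {i : Fin n} {s s' : Fin R → Fin n}
    (hstep : SeedStep Xhat i s s') :
    (∀ r, (∃ j, cl (s j) = r) → ∃ j, cl (s' j) = r) ∧ ∃ j, cl (s' j) = cl i := by
  obtain ⟨y, z, hyz, hmax, hcase⟩ := hstep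
  -- The chosen pair is maximal, so if it is below `t`, all pairs are.
  have hsurj : inner ℝ (Xhat (s y)) (Xhat (s z)) < t → ∃ j, cl (s j) = cl i := fun hlt =>
    h.surjective_of_forall_lt (fun y' z' hne => (hmax y' z' hne).trans_lt hlt) (cl i)
  rcases hcase with ⟨hle, rfl⟩ | ⟨⟨j, hj⟩, rfl⟩
  · refine ⟨?_, z, by simp⟩
    rintro r ⟨j, hj⟩
    by_cases hjz : j = z
    · subst hjz
      by_cases hcl : cl (s y) = cl (s j)
      · exact ⟨y, by rw [Function.update_of_ne hyz, hcl, hj]⟩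
      -- The replaced seed could be the last one of its class only if `y` and `z` are in different
      -- classes. Then all classes are represented, and a seed in the class of `i` exceeds the
      -- maximal pair, so no replacement is allowed.
      · have hlt := h.2 _ _ hcl
        obtain ⟨k, hk⟩ := hsurj hlt
        exact absurd ((h.1 _ _ hk.symm).trans_le (hle k)) (not_lt.2 hlt.le)
    · exact ⟨j, by rw [Function.update_of_ne hjz, hj]⟩
  · refine ⟨fun r hr => hr, ?_⟩
    by_cases hcl : cl i = cl (s' j)
    · exact ⟨j, hcl.symm⟩
    · exact hsurj (hj.trans_lt (h.2 _ _ hcl))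

/-- If a threshold separates the classes, the algorithm recovers them. -/
theorem AlgorithmRun.exists_perm_of_separatesClasses {R d n : ℕ} {G : SimpleGraph (Fin n)}
    (run : AlgorithmRun R d G) {cl : Fin n → Fin R} (hcl : Function.Surjective cl) {t : ℝ}
    (h : SeparatesClasses run.Xhat cl t) :
    ∃ σ : Equiv.Perm (Fin R), ∀ r, run.Hhat (σ r) = Finset.univ.filter fun i => cl i = r := by
  -- Invariant: the classes of all vertices processed so far are represented, whatever the initial
  -- seeds.
  have hrep : ∀ k : Fin (n + 1), ∀ i : Fin n, (i : ℕ) < k →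
      ∃ j, cl (run.seeds k j) = cl i := by
    intro k
    induction k using Fin.induction with
    | zero => intro i hi; simp at hi
    | succ k ih =>
      intro i hi
      have hstep := (run.seedStep k).represented h
      rcases Nat.lt_succ_iff_lt_or_eq.1 (show (i : ℕ) < (k : ℕ) + 1 from hi) with hlt | heq
      · exact hstep.1 _ (ih i (by simpa using hlt))
      · rw [Fin.ext heq]; exact hstep.2
  set s := run.seeds (Fin.last n)
  have hsurj : Function.Surjective (cl ∘ s) := fun r => by
    obtain ⟨i, rfl⟩ := hcl r
    exact hrep (Fin.last n) i (by simp)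
  have hbij : Function.Bijective (cl ∘ s) :=
    ⟨Finite.injective_iff_surjective.2 hsurj, hsurj⟩
  have hτ : ∀ i, cl (s (run.τhat i)) = cl i := fun i => by
    obtain ⟨j, hj⟩ := hsurj (cl i)
    by_contra hne
    exact lt_asymm ((h.1 i (s j) hj.symm).trans_le (run.argmax i j)) (h.2 _ _ (Ne.symm hne))
  refine ⟨(Equiv.ofBijective _ hbij).symm, fun r => ?_⟩
  obtain ⟨j, rfl⟩ := hsurj r
  have hj : (Equiv.ofBijective _ hbij).symm ((cl ∘ s) j) = j :=
    (Equiv.ofBijective _ hbij).symm_apply_apply j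
  rw [hj]
  ext i
  simp only [AlgorithmRun.Hhat, cluster, Finset.mem_insert, Finset.mem_filter, Finset.mem_univ,
    true_and]
  constructor
  -- Adding the vertex of the seed changes nothing, since it already lies in the class.
  · rintro (rfl | rfl)
    · rfl
    · exact (hτ i).symm
  · intro hi
    exact Or.inr (hbij.1 (by simpa [hi] using hτ i))

end Seeds

/-! ### From Gram matrices to aligned positions and the kernel statistic. -/

section Statistic

/-- Points whose Gram matrix is close to a given matrix are close to points whose Gram matrix is
equal to it. -/
theorem exists_gram_eq_of_gram_close {ι E : Type*} [Finite ι] [NormedAddCommGroup E]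
    [InnerProductSpace ℝ E] [FiniteDimensional ℝ E] (Γ : ι → ι → ℝ) {ε : ℝ} (hε : 0 < ε) :
    ∃ δ : ℝ, 0 < δ ∧ ∀ z : ι → E, (∀ a b, |inner ℝ (z a) (z b) - Γ a b| ≤ δ) →
      ∃ y : ι → E, (∀ a b, inner ℝ (y a) (y b) = Γ a b) ∧ ∀ a, ‖z a - y a‖ ≤ ε := by
  have := Fintype.ofFinite ι
  -- Compactness: counterexamples with error `1 / (n + 1)` are bounded by the diagonal of `Γ`, and a
  -- limit point realises `Γ` exactly while being approached by them.
  by_contra! hcon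
  choose z hz hbad using fun n : ℕ => hcon (1 / ((n : ℝ) + 1)) (by positivity)
  have hlim0 : Filter.Tendsto (fun n : ℕ => 1 / ((n : ℝ) + 1)) Filter.atTop (nhds 0) :=
    tendsto_one_div_add_atTop_nhds_zero_nat
  have hbdd : ∀ n, z n ∈ Metric.closedBall (0 : ι → E) (∑ a, (|Γ a a| + 2)) := fun n => by
    rw [mem_closedBall_zero_iff, pi_norm_le_iff_of_nonneg (by positivity)]
    intro a
    have h1 := hz n a a
    rw [real_inner_self_eq_norm_sq] at h1
    have h2 : 1 / ((n : ℝ) + 1) ≤ 1 := by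
      rw [div_le_one (by positivity)]; linarith [Nat.cast_nonneg (α := ℝ) n]
    have h3 : ‖z n a‖ ≤ |Γ a a| + 2 := by
      have h4 := (abs_le.1 h1).2
      have h5 := le_abs_self (Γ a a)
      nlinarith [sq_nonneg (‖z n a‖ - 1), abs_nonneg (Γ a a)]
    exact h3.trans (Finset.single_le_sum (f := fun a => |Γ a a| + 2)
      (fun _ _ => by positivity) (Finset.mem_univ a))
  obtain ⟨y, -, ψ, hψ, hy⟩ := (isCompact_closedBall (0 : ι → E) _).tendsto_subseq hbdd
  have hya : ∀ a, Filter.Tendsto (fun n => z (ψ n) a) Filter.atTop (nhds (y a)) := fun a =>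
    (tendsto_pi_nhds.1 hy) a
  have hgram : ∀ a b, inner ℝ (y a) (y b) = Γ a b := fun a b => by
    have h1 : Filter.Tendsto (fun n => inner ℝ (z (ψ n) a) (z (ψ n) b) - Γ a b) Filter.atTop
        (nhds (inner ℝ (y a) (y b) - Γ a b)) := ((hya a).inner (hya b)).sub_const _
    have h2 : Filter.Tendsto (fun n => inner ℝ (z (ψ n) a) (z (ψ n) b) - Γ a b) Filter.atTop
        (nhds 0) := squeeze_zero_norm (fun n => hz (ψ n) a b) (hlim0.comp hψ.tendsto_atTop)
    exact sub_eq_zero.1 (tendsto_nhds_unique h1 h2)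
  obtain ⟨n, hn⟩ := ((Metric.tendsto_atTop.1 hy) ε hε)
  obtain ⟨a, ha⟩ := hbad (ψ n) y hgram
  have h1 : ‖z (ψ n) - y‖ < ε := by rw [← dist_eq_norm]; exact hn n le_rfl
  exact absurd ((norm_le_pi_norm (z (ψ n) - y) a).trans_lt h1) (not_lt.2 ha.le)

/-- Uniform continuity of a radial kernel near the unit ball. -/
theorem exists_radial_kernel_close {E : Type*} [NormedAddCommGroup E] {φ : ℝ → ℝ}
    (hφ : Continuous φ) {η : ℝ} (hη : 0 < η) :
    ∃ δ : ℝ, 0 < δ ∧ ∀ a b a' b' : E, ‖a'‖ ≤ 1 → ‖b'‖ ≤ 1 → ‖a - a'‖ ≤ δ → ‖b - b'‖ ≤ δ →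
      |φ ‖a - b‖ - φ ‖a' - b'‖| ≤ η := by
  -- Distances in the unit ball are at most `2`, and moving both points by at most `1` gives at most
  -- `4`.
  have huc : UniformContinuousOn φ (Set.Icc 0 4) :=
    isCompact_Icc.uniformContinuousOn_of_continuous hφ.continuousOn
  obtain ⟨δ, hδ, h⟩ := Metric.uniformContinuousOn_iff.1 huc η hη
  refine ⟨min 1 (δ / 3), by positivity, fun a b a' b' ha' hb' ha hb => ?_⟩
  have ha1 := ha.trans (min_le_left _ _)
  have hb1 := hb.trans (min_le_left _ _)
  have ha2 := ha.trans (min_le_right _ _)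
  have hb2 := hb.trans (min_le_right _ _)
  have h0 : |‖a - b‖ - ‖a' - b'‖| ≤ ‖a - a'‖ + ‖b - b'‖ := by
    refine (abs_norm_sub_norm_le _ _).trans ?_
    have : a - b - (a' - b') = (a - a') - (b - b') := by abel
    rw [this]; exact norm_sub_le _ _
  have h1 : ‖a' - b'‖ ≤ 2 := (norm_sub_le _ _).trans (by linarith)
  have h2 : ‖a - b‖ ≤ 4 := by linarith [(abs_le.1 h0).2]
  have := h ‖a - b‖ ⟨norm_nonneg _, h2⟩ ‖a' - b'‖ ⟨norm_nonneg _, by linarith⟩ (by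
    rw [Real.dist_eq]; linarith)
  rw [Real.dist_eq] at this
  exact this.le

/-- The statistic consists of three averages with coefficients `1`, `-2`, `1`, so a uniform kernel
error contributes at most `1 + 2 + 1` times. -/
theorem abs_testStatistic_sub_le {V E : Type*} [DecidableEq V] [NormedAddCommGroup E]
    {φ : ℝ → ℝ} {H H' : Finset V} {X X' Y Y' : V → E} {η : ℝ}
    (h₁ : ∀ i ∈ H, ∀ j ∈ H, |φ ‖X i - X j‖ - φ ‖X' i - X' j‖| ≤ η)
    (h₂ : ∀ i ∈ H, ∀ k ∈ H', |φ ‖X i - Y k‖ - φ ‖X' i - Y' k‖| ≤ η)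
    (h₃ : ∀ k ∈ H', ∀ l ∈ H', |φ ‖Y k - Y l‖ - φ ‖Y' k - Y' l‖| ≤ η) (hη : 0 ≤ η) :
    |testStatistic φ H X H' Y - testStatistic φ H X' H' Y'| ≤ 4 * η := by
  have hdiag : ∀ (H : Finset V) (X X' : V → E),
      (∀ i ∈ H, ∀ j ∈ H, |φ ‖X i - X j‖ - φ ‖X' i - X' j‖| ≤ η) →
      |1 / ((H.card : ℝ) * ((H.card : ℝ) - 1)) * (∑ i ∈ H, ∑ j ∈ H.erase i, φ ‖X i - X j‖) -
        1 / ((H.card : ℝ) * ((H.card : ℝ) - 1)) *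
          (∑ i ∈ H, ∑ j ∈ H.erase i, φ ‖X' i - X' j‖)| ≤ η := by
    intro H X X' h
    rw [← mul_sub, ← Finset.sum_sub_distrib]
    rcases H.eq_empty_or_nonempty with rfl | hne
    · simpa using hη
    have hc : (1 : ℝ) ≤ H.card := by exact_mod_cast hne.card_pos
    have hs : |∑ i ∈ H, (∑ j ∈ H.erase i, φ ‖X i - X j‖ - ∑ j ∈ H.erase i, φ ‖X' i - X' j‖)| ≤
        (H.card : ℝ) * (((H.card : ℝ) - 1) * η) := by
      rw [← nsmul_eq_mul]
      refine (Finset.abs_sum_le_sum_abs _ _).trans (Finset.sum_le_card_nsmul _ _ _ fun i hi => ?_)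
      rw [← Finset.sum_sub_distrib]
      have : ((H.card : ℝ) - 1) * η = (H.erase i).card • η := by
        rw [Finset.card_erase_of_mem hi, nsmul_eq_mul, Nat.cast_sub hne.card_pos, Nat.cast_one]
      rw [this]
      exact (Finset.abs_sum_le_sum_abs _ _).trans (Finset.sum_le_card_nsmul _ _ _ fun j hj =>
        h i hi j (Finset.mem_of_mem_erase hj))
    rw [abs_mul, abs_of_nonneg (by have := sub_nonneg.2 hc; positivity)]
    -- A single point makes the normalisation `1 / 0 = 0`, and both terms vanish.
    rcases hc.eq_or_lt with h1 | h1
    · rw [← h1]; simpa using hη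
    · have h2 := sub_pos.2 h1
      rw [one_div, inv_mul_le_iff₀ (by positivity)]
      linarith
  have hcross : |2 / ((H'.card : ℝ) * (H.card : ℝ)) * (∑ i ∈ H, ∑ k ∈ H', φ ‖X i - Y k‖) -
      2 / ((H'.card : ℝ) * (H.card : ℝ)) * (∑ i ∈ H, ∑ k ∈ H', φ ‖X' i - Y' k‖)| ≤ 2 * η := by
    rw [← mul_sub, ← Finset.sum_sub_distrib]
    have hs : |∑ i ∈ H, (∑ k ∈ H', φ ‖X i - Y k‖ - ∑ k ∈ H', φ ‖X' i - Y' k‖)| ≤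
        (H.card : ℝ) * ((H'.card : ℝ) * η) := by
      rw [← nsmul_eq_mul]
      refine (Finset.abs_sum_le_sum_abs _ _).trans (Finset.sum_le_card_nsmul _ _ _ fun i hi => ?_)
      rw [← Finset.sum_sub_distrib, ← nsmul_eq_mul]
      exact (Finset.abs_sum_le_sum_abs _ _).trans (Finset.sum_le_card_nsmul _ _ _ fun k hk =>
        h₂ i hi k hk)
    rw [abs_mul, abs_of_nonneg (by positivity)]
    rcases H.eq_empty_or_nonempty with rfl | hne
    · simpa using hη
    rcases H'.eq_empty_or_nonempty with rfl | hne'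
    · simpa using hη
    have hc : (0 : ℝ) < H.card := by exact_mod_cast hne.card_pos
    have hc' : (0 : ℝ) < H'.card := by exact_mod_cast hne'.card_pos
    rw [div_mul_eq_mul_div, div_le_iff₀ (by positivity)]
    linarith
  have e₁ := abs_le.1 (hdiag H X X' h₁)
  have e₂ := abs_le.1 hcross
  have e₃ := abs_le.1 (hdiag H' Y Y' h₃)
  simp only [testStatistic]
  rw [abs_le]
  constructor <;> linarith [e₁.1, e₁.2, e₂.1, e₂.2, e₃.1, e₃.2]

/-- Used for two vertices with the same latent position, where all three true inner products
coincide. -/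
theorem norm_sub_sq_le_of_inner_close {E : Type*} [NormedAddCommGroup E] [InnerProductSpace ℝ E]
    {a b : E} {c δ : ℝ} (haa : |inner ℝ a a - c| ≤ δ) (hab : |inner ℝ a b - c| ≤ δ)
    (hbb : |inner ℝ b b - c| ≤ δ) : ‖a - b‖ ^ 2 ≤ 4 * δ := by
  rw [norm_sub_sq_real, ← real_inner_self_eq_norm_sq, ← real_inner_self_eq_norm_sq]
  linarith [(abs_le.1 haa).2, (abs_le.1 hab).1, (abs_le.1 hbb).2]

/-- If the Gram matrix of `Xhat` is close to that of the latent positions, which take finitely many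
values, each of them for a positive proportion of the vertices, then aligned latent positions are
uniformly close to `Xhat`. -/
theorem IsAlignedLatent.exists_norm_sub_le {K d : ℕ} {ι : Type*} [Fintype ι]
    (x : Fin K → EuclideanSpace ℝ ι) {w ε : ℝ} (hw : 0 < w) (hε : 0 < ε) :
    ∃ δ : ℝ, 0 < δ ∧ ∀ (n : ℕ) (H : Finset (Fin n)) (X : Fin n → EuclideanSpace ℝ ι)
      (Xhat Y : Fin n → EuclideanSpace ℝ (Fin d)),
      (∀ i ∈ H, ∃ k, X i = x k) →
      (∀ k, ∃ S ⊆ H, (∀ i ∈ S, X i = x k) ∧ w * n ≤ S.card) →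
      (∀ i ∈ H, ∀ j ∈ H, |inner ℝ (Xhat i) (Xhat j) - inner ℝ (X i) (X j)| ≤ δ) →
      IsAlignedLatent H X Xhat Y → ∀ i ∈ H, ‖Xhat i - Y i‖ ≤ ε := by
  -- Chosen so that the competitor's cost `4 e² n = w n ε² / 16` is below `w n (ε / 2)²`, the cost
  -- of a block that is off by `ε / 2`.
  set e : ℝ := ε * Real.sqrt w / 8 with he
  have hsw : 0 < Real.sqrt w := Real.sqrt_pos.2 hw
  have he0 : 0 < e := by positivity
  obtain ⟨δ, hδ, hreal⟩ := exists_gram_eq_of_gram_close (E := EuclideanSpace ℝ (Fin d))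
    (fun a b : Fin K => inner ℝ (x a) (x b)) he0
  set g : ℝ := min e (ε / 2) with hg
  have hg0 : 0 < g := by positivity
  refine ⟨min δ (g ^ 2 / 4), by positivity, ?_⟩
  intro n H X Xhat Y hX hcount hgram halign i₀ hi₀
  have hn : 0 < (n : ℝ) := by
    have : 0 < n := i₀.pos
    exact_mod_cast this
  have hclose : ∀ i ∈ H, ∀ j ∈ H, X i = X j → ‖Xhat i - Xhat j‖ ≤ g := fun i hi j hj hij => by
    refine le_of_sq_le_sq ?_ hg0.le
    refine (norm_sub_sq_le_of_inner_close (c := inner ℝ (X i) (X i))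
      ((hgram i hi i hi).trans (min_le_right _ _)) ?_ ?_).trans (le_of_eq ?_)
    · have := (hgram i hi j hj).trans (min_le_right _ _)
      rwa [← hij] at this
    · have := (hgram j hj j hj).trans (min_le_right _ _)
      rwa [← hij] at this
    · ring
  have hrep : ∀ k, ∃ i ∈ H, X i = x k := fun k => by
    obtain ⟨S, hS, hSx, hc⟩ := hcount k
    have hpos : 0 < S.card := by
      have : (0 : ℝ) < S.card := lt_of_lt_of_le (by positivity) hc
      exact_mod_cast this
    obtain ⟨i, hi⟩ := Finset.card_pos.1 hpos
    exact ⟨i, hS hi, hSx i hi⟩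
  choose rep hrepH hrepX using hrep
  -- An exact realisation near one representative per block, extended blockwise to a competitor for
  -- the aligned `Y`.
  obtain ⟨y, hy, hzy⟩ := hreal (fun k => Xhat (rep k)) fun a b => by
    have := (hgram _ (hrepH a) _ (hrepH b)).trans (min_le_left _ _)
    rwa [hrepX, hrepX] at this
  have hk : ∀ i, ∃ k, i ∈ H → X i = x k := fun i => by
    by_cases hi : i ∈ H
    · obtain ⟨k, hk⟩ := hX i hi
      exact ⟨k, fun _ => hk⟩
    · obtain ⟨k, -⟩ := hX i₀ hi₀
      exact ⟨k, fun h => absurd h hi⟩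
  choose κ hκ using hk
  have hlat : IsLatentOn H X fun i => y (κ i) := fun i hi j hj => by
    rw [hy, hκ i hi, hκ j hj]
  have hY' : ∀ i ∈ H, ‖Xhat i - y (κ i)‖ ≤ 2 * e := fun i hi => by
    have h1 := hclose i hi (rep (κ i)) (hrepH _) (by rw [hrepX, hκ i hi])
    have h2 := hzy (κ i)
    have h3 := norm_sub_le_norm_sub_add_norm_sub (Xhat i) (Xhat (rep (κ i))) (y (κ i))
    have h4 : g ≤ e := min_le_left _ _
    linarith
  have hsum : ∑ i ∈ H, ‖Xhat i - Y i‖ ^ 2 ≤ n * (4 * e ^ 2) := by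
    refine (halign.2 _ hlat).trans ?_
    have h1 : ∑ i ∈ H, ‖Xhat i - y (κ i)‖ ^ 2 ≤ H.card • (4 * e ^ 2) :=
      Finset.sum_le_card_nsmul _ _ _ fun i hi => by
        have := pow_le_pow_left₀ (norm_nonneg _) (hY' i hi) 2
        linarith [this, mul_pow (2 : ℝ) e 2]
    refine h1.trans ?_
    rw [nsmul_eq_mul]
    have : (H.card : ℝ) ≤ n := by
      exact_mod_cast (Finset.card_le_univ H).trans (by simp)
    gcongr
  -- One bad vertex makes its whole block bad: `Xhat` is nearly constant there, and `Y` exactly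
  -- constant because its Gram matrix is exact. A block has at least `w n` vertices, so minimality
  -- fails.
  by_contra! hbig
  obtain ⟨k, hk⟩ := hX i₀ hi₀
  obtain ⟨S, hS, hSx, hc⟩ := hcount k
  have hlow : ∀ i ∈ S, (ε / 2) ^ 2 ≤ ‖Xhat i - Y i‖ ^ 2 := fun i hi => by
    have hXi : X i = X i₀ := by rw [hSx i hi, hk]
    have hYi : Y i = Y i₀ := by
      have hz : ‖Y i - Y i₀‖ ^ 2 = 0 := by
        rw [norm_sub_sq_real, ← real_inner_self_eq_norm_sq, ← real_inner_self_eq_norm_sq,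
          halign.1 i (hS hi) i (hS hi), halign.1 i (hS hi) i₀ hi₀, halign.1 i₀ hi₀ i₀ hi₀, hXi]
        ring
      exact sub_eq_zero.1 (norm_eq_zero.1 (pow_eq_zero_iff two_ne_zero |>.1 hz))
    have h1 := hclose i₀ hi₀ i (hS hi) hXi.symm
    have h2 := norm_sub_le_norm_sub_add_norm_sub (Xhat i₀) (Xhat i) (Y i₀)
    have h3 : g ≤ ε / 2 := min_le_right _ _
    refine pow_le_pow_left₀ (by positivity) ?_ 2
    rw [hYi]; linarith
  have h1 : S.card • (ε / 2) ^ 2 ≤ ∑ i ∈ S, ‖Xhat i - Y i‖ ^ 2 :=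
    Finset.card_nsmul_le_sum _ _ _ hlow
  have h2 : ∑ i ∈ S, ‖Xhat i - Y i‖ ^ 2 ≤ ∑ i ∈ H, ‖Xhat i - Y i‖ ^ 2 :=
    Finset.sum_le_sum_of_subset_of_nonneg hS fun _ _ _ => by positivity
  have h3 : w * n * (ε / 2) ^ 2 ≤ n * (4 * e ^ 2) := by
    rw [nsmul_eq_mul] at h1
    have : w * n * (ε / 2) ^ 2 ≤ S.card * (ε / 2) ^ 2 := by gcongr
    linarith
  have h4 : e ^ 2 = ε ^ 2 * w / 64 := by
    rw [he, div_pow, mul_pow, Real.sq_sqrt hw.le]; norm_num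
  rw [h4] at h3
  have h5 : 0 < n * (ε ^ 2 * w) := by positivity
  nlinarith

end Statistic

/-! ### Operator norm of the noise; induced subgraphs; frame bounds. -/

section Noise

/-- The difference between the adjacency matrix and the matrix of edge probabilities. -/
noncomputable def edgeNoise {ι : Type*} [Fintype ι] {n : ℕ} (X : Fin n → EuclideanSpace ℝ ι)
    (G : SimpleGraph (Fin n)) (i j : Fin n) : ℝ :=
  adjacency G i j - inner ℝ (X i) (X j)

theorem adjacency_apply {n : ℕ} (G : SimpleGraph (Fin n)) (i j : Fin n) [Decidable (G.Adj i j)] :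
    adjacency G i j = if G.Adj i j then 1 else 0 := by
  classical
  simp [adjacency, SimpleGraph.adjMatrix_apply]

theorem adjacency_comm {n : ℕ} (G : SimpleGraph (Fin n)) (i j : Fin n) :
    adjacency G i j = adjacency G j i := by
  classical
  simp [adjacency_apply, G.adj_comm]

variable {ι : Type*} [Fintype ι] {n : ℕ} {X : Fin n → EuclideanSpace ℝ ι}
  {G : SimpleGraph (Fin n)}

theorem abs_edgeNoise_le {i j : Fin n} (h : inner ℝ (X i) (X j) ∈ Set.Icc (0 : ℝ) 1) :
    |edgeNoise X G i j| ≤ 1 := by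
  classical
  rw [edgeNoise, adjacency_apply, abs_le]
  split_ifs <;> constructor <;> linarith [h.1, h.2]

/-- A symmetric matrix with bounded entries whose square has small off-diagonal entries has small
operator norm. -/
theorem sum_sq_sum_mul_le_of_square_offDiag {V : Type*} [Fintype V]
    {E : V → V → ℝ} (hE : ∀ i j, |E i j| ≤ 1) {γ : ℝ} (hγ : 0 ≤ γ)
    (hoff : ∀ i j, i ≠ j → |∑ k, E k i * E k j| ≤ γ) (h : V → ℝ) :
    ∑ i, (∑ j, E i j * h j) ^ 2 ≤ (Fintype.card V * γ + Fintype.card V) * ∑ j, h j ^ 2 := by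
  classical
  have h1 : ∑ i, (∑ j, E i j * h j) ^ 2 =
      ∑ j, ∑ k, (∑ i, E i j * E i k) * (h j * h k) := by
    simp only [pow_two, Finset.sum_mul_sum]
    rw [Finset.sum_comm]
    refine Finset.sum_congr rfl fun j _ => ?_
    rw [Finset.sum_comm]
    refine Finset.sum_congr rfl fun k _ => ?_
    rw [Finset.sum_mul]
    exact Finset.sum_congr rfl fun i _ => by ring
  -- The diagonal of `Eᵀ E` contributes `card V`; the rest contributes `γ (∑ |h j|)²`, bounded by
  -- Cauchy–Schwarz.
  have h2 : ∀ j k, (∑ i, E i j * E i k) * (h j * h k) ≤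
      γ * (|h j| * |h k|) + if j = k then (Fintype.card V : ℝ) * h j ^ 2 else 0 := by
    intro j k
    split_ifs with hjk
    · subst hjk
      have h3 : ∑ i, E i j * E i j ≤ Fintype.card V := by
        have : ∑ i, E i j * E i j ≤ ∑ _i : V, (1 : ℝ) := Finset.sum_le_sum fun i _ => by
          rw [← abs_mul_abs_self]
          nlinarith [hE i j, abs_nonneg (E i j)]
        simpa using this
      have h4 : (∑ i, E i j * E i j) * (h j * h j) ≤ Fintype.card V * h j ^ 2 := by
        rw [← pow_two]; gcongr
      have h5 : 0 ≤ γ * (|h j| * |h j|) := by positivity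
      linarith
    · rw [add_zero]
      refine (le_abs_self _).trans ?_
      rw [abs_mul, abs_mul]
      exact mul_le_mul_of_nonneg_right (hoff j k hjk) (by positivity)
  rw [h1]
  refine (Finset.sum_le_sum fun j _ => Finset.sum_le_sum fun k _ => h2 j k).trans ?_
  simp only [Finset.sum_add_distrib, Finset.sum_ite_eq, Finset.mem_univ, if_true,
    ← Finset.mul_sum]
  rw [← Finset.sum_mul, ← pow_two, add_mul]
  have h3 : (∑ j, |h j|) ^ 2 ≤ Fintype.card V * ∑ j, h j ^ 2 := by
    have := sq_sum_le_card_mul_sum_sq (s := (Finset.univ : Finset V)) (f := fun j => |h j|)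
    simpa [sq_abs] using this
  have := mul_le_mul_of_nonneg_left h3 hγ
  linarith

/-- The spectral embedding of an induced subgraph recovers the Gram matrix of the latent
positions, if the noise is small. -/
theorem IsASE.abs_inner_sub_inner_le_of_edgeNoise {V F : Type*} [Fintype V] [DecidableEq V]
    [NormedAddCommGroup F] [InnerProductSpace ℝ F] [FiniteDimensional ℝ F] {m : ℕ}
    (hm : Module.finrank ℝ F = m) {e : V → Fin n} (he : Function.Injective e) (Y : V → F)
    (hYX : ∀ a b, inner ℝ (Y a) (Y b) = inner ℝ (X (e a)) (X (e b)))
    (hX : ∀ i j, inner ℝ (X i) (X j) ∈ Set.Icc (0 : ℝ) 1)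
    {l δ : ℝ} (hl : 0 < l) (hδ : 0 < δ) (hδl : δ ≤ l / 4) (hn : 1 ≤ δ ^ 2 / 2 * n)
    (hlow : ∀ v : F, l * n * ‖v‖ ^ 2 ≤ ∑ a, inner ℝ (Y a) v ^ 2)
    (hsq : ∀ i j, i ≠ j → |∑ k, edgeNoise X G k i * edgeNoise X G k j| ≤ δ ^ 2 / 2 * n)
    (hdev : ∀ a, ‖∑ b, edgeNoise X G (e a) (e b) • X (e b)‖ ≤ δ * n)
    {Xhat : V → EuclideanSpace ℝ (Fin m)} (hASE : IsASE ((adjacency G).submatrix e e) Xhat)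
    (a b : V) :
    |inner ℝ (Xhat a) (Xhat b) - inner ℝ (X (e a)) (X (e b))| ≤ (8 / l ^ 2 + 3 / l) * δ := by
  have hn0 : (0 : ℝ) < n := by
    by_contra hc
    have : (n : ℝ) ≤ 0 := not_lt.1 hc
    nlinarith [sq_nonneg δ]
  have hcard : (Fintype.card V : ℝ) ≤ n := by
    exact_mod_cast (Fintype.card_le_of_injective e he).trans (by simp)
  have hent : ∀ a b, (adjacency G).submatrix e e a b - inner ℝ (Y a) (Y b) =
      edgeNoise X G (e a) (e b) := fun a b => by rw [hYX]; rfl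
  -- Norms of linear combinations depend only on the Gram matrix, so the row sums may be taken with
  -- the ambient positions.
  have hgramnorm : ∀ c : V → ℝ, ‖∑ b, c b • Y b‖ = ‖∑ b, c b • X (e b)‖ := fun c => by
    rw [← sq_eq_sq₀ (norm_nonneg _) (norm_nonneg _), ← real_inner_self_eq_norm_sq,
      ← real_inner_self_eq_norm_sq]
    simp only [sum_inner, inner_sum, inner_smul_left, inner_smul_right, hYX]
  rw [← hYX]
  refine hASE.abs_inner_sub_inner_le hm ?_ Y hn0 hl hδ.le hδl hlow ?_ ?_ ?_ ?_ a b
  · ext a b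
    exact adjacency_comm _ _ _
  · intro a
    rw [← sq_le_sq₀ (norm_nonneg _) zero_le_one, ← real_inner_self_eq_norm_sq, hYX, one_pow]
    exact (hX _ _).2
  · intro a
    classical
    refine le_trans ?_ hcard
    have : ∑ b, (adjacency G).submatrix e e a b ^ 2 ≤ ∑ _b : V, (1 : ℝ) :=
      Finset.sum_le_sum fun b _ => by
        rw [Matrix.submatrix_apply, adjacency_apply]
        split_ifs <;> norm_num
    simpa using this
  · intro h
    simp only [hent]
    classical
    -- Extension of `h` by zero: a compression to a subset of the vertices has no larger norm than
    -- the full noise.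
    set g : Fin n → ℝ := fun k => ∑ b, if e b = k then h b else 0 with hg
    have hge : ∀ b, g (e b) = h b := fun b => by
      simp [hg, he.eq_iff]
    have hsupp : ∀ k, k ∉ Set.range e → g k = 0 := fun k hk => by
      refine Finset.sum_eq_zero fun b _ => if_neg fun hb => hk ⟨b, hb⟩
    have hsum : ∀ f : Fin n → ℝ → ℝ, (∀ k, f k 0 = 0) → ∑ k, f k (g k) = ∑ b, f (e b) (h b) := by
      intro f hf
      rw [← Finset.sum_subset (Finset.subset_univ (Finset.univ.image e)), Finset.sum_image
        (fun a _ b _ hab => he hab)]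
      · exact Finset.sum_congr rfl fun b _ => by rw [hge]
      · intro k _ hk
        rw [hsupp k (by simpa using hk), hf]
    have hbound := sum_sq_sum_mul_le_of_square_offDiag (E := edgeNoise X G)
      (fun i j => abs_edgeNoise_le (hX i j)) (γ := δ ^ 2 / 2 * n) (by positivity) hsq g
    have h1 : ∑ a, (∑ b, edgeNoise X G (e a) (e b) * h b) ^ 2 ≤
        ∑ i, (∑ j, edgeNoise X G i j * g j) ^ 2 := by
      rw [← Finset.sum_image (s := Finset.univ) (g := e)
        (f := fun i => (∑ b, edgeNoise X G i (e b) * h b) ^ 2) (fun a _ b _ hab => he hab)]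
      refine (Finset.sum_le_sum_of_subset_of_nonneg (Finset.subset_univ _)
        fun _ _ _ => by positivity).trans (le_of_eq ?_)
      refine Finset.sum_congr rfl fun i _ => ?_
      rw [hsum (fun j y => edgeNoise X G i j * y) (by simp)]
    refine h1.trans (hbound.trans ?_)
    rw [hsum (fun _ y => y ^ 2) (by simp), mul_pow, EuclideanSpace.norm_sq_eq]
    simp only [Real.norm_eq_abs, sq_abs, Fintype.card_fin]
    refine mul_le_mul_of_nonneg_right ?_ (Finset.sum_nonneg fun _ _ => sq_nonneg _)
    nlinarith
  · intro a
    simp only [hent]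
    rw [hgramnorm]
    exact hdev a

/-- Vectors that span the space form a frame. -/
theorem exists_lower_frame_bound {κ F : Type*} [Fintype κ] [NormedAddCommGroup F]
    [InnerProductSpace ℝ F] [FiniteDimensional ℝ F] (y : κ → F)
    (hy : Submodule.span ℝ (Set.range y) = ⊤) :
    ∃ l : ℝ, 0 < l ∧ ∀ v : F, l * ‖v‖ ^ 2 ≤ ∑ k, inner ℝ (y k) v ^ 2 := by
  have hker : LinearMap.ker (analysisMap y) = ⊥ := by
    rw [Submodule.eq_bot_iff]
    intro v hv
    have h1 : ∀ k, inner ℝ (y k) v = 0 := fun k => by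
      rw [← analysisMap_apply, LinearMap.mem_ker.1 hv]; rfl
    have h2 : ∀ z ∈ Submodule.span ℝ (Set.range y), inner ℝ z v = 0 := by
      intro z hz
      induction hz using Submodule.span_induction with
      | mem z hz => obtain ⟨k, rfl⟩ := hz; exact h1 k
      | zero => simp
      | add a b _ _ ha hb => rw [inner_add_left, ha, hb, add_zero]
      | smul c a _ ha => rw [inner_smul_left, ha, mul_zero]
    have h3 := h2 v (by rw [hy]; trivial)
    rwa [inner_self_eq_zero] at h3
  obtain ⟨C, hC, hanti⟩ := LinearMap.exists_antilipschitzWith _ hker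
  have hC' : (0 : ℝ) < C := hC
  refine ⟨1 / (C : ℝ) ^ 2, by positivity, fun v => ?_⟩
  have h1 := hanti.le_mul_dist v 0
  rw [map_zero, dist_zero_right, dist_zero_right] at h1
  have h2 := pow_le_pow_left₀ (norm_nonneg _) h1 2
  rw [mul_pow, EuclideanSpace.norm_sq_eq] at h2
  simp only [analysisMap_apply, Real.norm_eq_abs, sq_abs] at h2
  rw [one_div, inv_mul_le_iff₀ (by positivity)]
  exact h2

/-- If each of the vectors `y k` is taken often, a lower frame bound carries over. -/
theorem lower_frame_bound_of_count {κ V F : Type*} [Fintype κ] [Fintype V]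
    [NormedAddCommGroup F] [InnerProductSpace ℝ F] {y : κ → F} {l : ℝ}
    (hl : ∀ v : F, l * ‖v‖ ^ 2 ≤ ∑ k, inner ℝ (y k) v ^ 2) {Y : V → F} {w N : ℝ} (hw : 0 ≤ w)
    (hN : 0 ≤ N) (hcount : ∀ k, ∃ S : Finset V, (∀ a ∈ S, Y a = y k) ∧ w * N ≤ S.card) (v : F) :
    l * w / (Fintype.card κ + 1) * N * ‖v‖ ^ 2 ≤ ∑ a, inner ℝ (Y a) v ^ 2 := by
  set T := ∑ a, inner ℝ (Y a) v ^ 2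
  have hT : 0 ≤ T := Finset.sum_nonneg fun _ _ => sq_nonneg _
  -- Values of `y` may repeat, so the sets `S` need not be disjoint. Each `k` is therefore compared
  -- with the whole sum `T`, at the price of a factor `card κ`.
  have h1 : ∀ k, w * N * inner ℝ (y k) v ^ 2 ≤ T := fun k => by
    obtain ⟨S, hS, hc⟩ := hcount k
    calc w * N * inner ℝ (y k) v ^ 2 ≤ S.card * inner ℝ (y k) v ^ 2 := by gcongr
      _ = ∑ a ∈ S, inner ℝ (Y a) v ^ 2 := by
        rw [Finset.sum_congr rfl fun a ha => by rw [hS a ha], Finset.sum_const, nsmul_eq_mul]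
      _ ≤ T := Finset.sum_le_sum_of_subset_of_nonneg (Finset.subset_univ _)
        fun _ _ _ => sq_nonneg _
  have h2 : w * N * ∑ k, inner ℝ (y k) v ^ 2 ≤ Fintype.card κ * T := by
    rw [Finset.mul_sum]
    simpa using Finset.sum_le_sum fun k (_ : k ∈ Finset.univ) => h1 k
  have h3 := mul_le_mul_of_nonneg_left (hl v) (mul_nonneg hw hN)
  have h4 : l * w / (Fintype.card κ + 1) * N * ‖v‖ ^ 2 =
      w * N * (l * ‖v‖ ^ 2) / (Fintype.card κ + 1) := by ring
  rw [h4, div_le_iff₀ (by positivity)]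
  linarith

end Noise

/-! ### Sub-Gaussian bounds for independent coins. -/

section Concentration

theorem ProbabilityTheory.HasSubgaussianMGF.of_le {Ω : Type*} [MeasurableSpace Ω] {μ : Measure Ω} {Z : Ω → ℝ}
    {c c' : NNReal} (h : HasSubgaussianMGF Z c μ) (hc : c ≤ c') : HasSubgaussianMGF Z c' μ where
  integrable_exp_mul := h.integrable_exp_mul
  mgf_le t := (h.mgf_le t).trans (by gcongr)

/-- Two-sided tail bound. -/
theorem ProbabilityTheory.HasSubgaussianMGF.measureReal_abs_ge_le {Ω : Type*} [MeasurableSpace Ω] {μ : Measure Ω}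
    [IsProbabilityMeasure μ] {Z : Ω → ℝ} {c : NNReal} (h : HasSubgaussianMGF Z c μ) {t : ℝ}
    (ht : 0 ≤ t) : μ.real {ω | t ≤ |Z ω|} ≤ 2 * Real.exp (-t ^ 2 / (2 * c)) := by
  have h1 := h.measure_ge_le ht
  have h2 := h.neg.measure_ge_le ht
  have hsub : {ω | t ≤ |Z ω|} ⊆ {ω | t ≤ Z ω} ∪ {ω | t ≤ (-Z) ω} := fun ω hω => by
    rcases le_abs.1 (show t ≤ |Z ω| from hω) with h | h
    · exact Or.inl h
    · exact Or.inr h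
  have h3 := (measureReal_mono hsub (μ := μ)).trans (measureReal_union_le _ _)
  linarith

variable {ε : Type*} [Fintype ε]

/-- Independent coins with success probabilities `P`. -/
noncomputable def coinMeasure (P : ε → unitInterval) : Measure (ε → Bool) :=
  Measure.pi fun e => bernoulliMeasure true false (P e)

noncomputable instance (P : ε → unitInterval) : IsProbabilityMeasure (coinMeasure P) := by
  unfold coinMeasure; infer_instance

/-- The centered outcome of a coin. -/
noncomputable def coinNoise {ε : Type*} (P : ε → unitInterval) (e : ε) (ω : ε → Bool) : ℝ :=
  (if ω e then 1 else 0) - P e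

variable (P : ε → unitInterval)

theorem iIndepFun_coinNoise : iIndepFun (coinNoise P) (coinMeasure P) :=
  iIndepFun_pi (μ := fun e => bernoulliMeasure true false (P e))
    (X := fun e (b : Bool) => (if b then (1 : ℝ) else 0) - P e)
    fun _ => (measurable_of_finite _).aemeasurable

theorem measurable_coinNoise {ε : Type*} (P : ε → unitInterval) (e : ε) : Measurable (coinNoise P e) :=
  (measurable_of_finite (fun b : Bool => (if b then (1 : ℝ) else 0) - P e)).comp
    (measurable_pi_apply e)

theorem integral_coinNoise (e : ε) : ∫ ω, coinNoise P e ω ∂coinMeasure P = 0 := by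
  have h := integral_comp_eval (μ := fun e => bernoulliMeasure true false (P e)) (i := e)
    (f := fun b : Bool => (if b then (1 : ℝ) else 0) - P e)
    (measurable_of_finite _).aestronglyMeasurable
  refine h.trans ?_
  rw [integral_bernoulliMeasure]
  simp
  ring

theorem abs_coinNoise_le {ε : Type*} (P : ε → unitInterval) (e : ε) (ω : ε → Bool) : |coinNoise P e ω| ≤ 1 := by
  have h := (P e).2
  rw [coinNoise, abs_le]
  split_ifs <;> constructor <;> linarith [h.1, h.2]

/-- Hoeffding's lemma on `[-1, 1]`, whose half-length is `1`. -/
theorem hasSubgaussianMGF_one_of_abs_le {Ω : Type*} [MeasurableSpace Ω] {μ : Measure Ω}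
    [IsProbabilityMeasure μ] {Z : Ω → ℝ} (hm : Measurable Z) (hb : ∀ ω, |Z ω| ≤ 1)
    (h0 : ∫ ω, Z ω ∂μ = 0) : HasSubgaussianMGF Z 1 μ := by
  have := hasSubgaussianMGF_of_mem_Icc_of_integral_eq_zero (a := -1) (b := 1) hm.aemeasurable
    (Filter.Eventually.of_forall fun ω => abs_le.1 (hb ω)) h0
  convert this using 1
  ext
  norm_num

theorem hasSubgaussianMGF_sum_coinNoise {κ : Type*} {a : κ → ε}
    (ha : Function.Injective a) {c : κ → ℝ} (hc : ∀ k, |c k| ≤ 1) (s : Finset κ) {n : ℕ}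
    (hs : s.card ≤ n) :
    HasSubgaussianMGF (fun ω => ∑ k ∈ s, c k * coinNoise P (a k) ω) n (coinMeasure P) := by
  have hind : iIndepFun (fun k ω => c k * coinNoise P (a k) ω) (coinMeasure P) :=
    ((iIndepFun_coinNoise P).precomp ha).comp (fun k y => c k * y)
      fun k => measurable_const_mul _
  have h1 := HasSubgaussianMGF.sum_of_iIndepFun hind (c := fun _ => 1) (s := s) fun k _ =>
    hasSubgaussianMGF_one_of_abs_le ((measurable_coinNoise P (a k)).const_mul _)
      (fun ω => by
        rw [abs_mul]
        exact mul_le_one₀ (hc k) (abs_nonneg _) (abs_coinNoise_le P _ ω))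
      (by rw [integral_const_mul, integral_coinNoise, mul_zero])
  refine h1.of_le ?_
  simpa using hs

/-- Different indices use disjoint pairs of coins, so the products are independent; each is centred
as a product of two independent centred variables. Induction adds one pair at a time. -/
theorem hasSubgaussianMGF_sum_coinNoise_mul {κ : Type*} [DecidableEq κ] [DecidableEq ε]
    {a b : κ → ε} (s : Finset κ) (ha : Set.InjOn a s) (hb : Set.InjOn b s)
    (hab : ∀ k ∈ s, ∀ l ∈ s, a k ≠ b l) :
    HasSubgaussianMGF (fun ω => ∑ k ∈ s, coinNoise P (a k) ω * coinNoise P (b k) ω) s.card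
      (coinMeasure P) := by
  induction s using Finset.induction_on with
  | empty => simp
  | insert k s hk ih =>
    have hks : ∀ l ∈ s, l ∈ insert k s := fun l hl => Finset.mem_insert_of_mem hl
    have hkk : k ∈ insert k s := Finset.mem_insert_self k s
    have ih' := ih (fun x hx y hy => ha (hks x hx) (hks y hy))
      (fun x hx y hy => hb (hks x hx) (hks y hy)) fun x hx y hy => hab x (hks x hx) y (hks y hy)
    have hind := iIndepFun_coinNoise P
    have h1 : HasSubgaussianMGF (fun ω => coinNoise P (a k) ω * coinNoise P (b k) ω) 1
        (coinMeasure P) := by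
      refine hasSubgaussianMGF_one_of_abs_le
        ((measurable_coinNoise P _).mul (measurable_coinNoise P _)) (fun ω => ?_) ?_
      · rw [abs_mul]
        exact mul_le_one₀ (abs_coinNoise_le P _ ω) (abs_nonneg _) (abs_coinNoise_le P _ ω)
      · rw [(hind.indepFun (hab k hkk k hkk)).integral_fun_mul_eq_mul_integral
          (measurable_coinNoise P _).aestronglyMeasurable
          (measurable_coinNoise P _).aestronglyMeasurable, integral_coinNoise, zero_mul]
    have hdisj : Disjoint ({a k, b k} : Finset ε) (s.image a ∪ s.image b) := by
      rw [Finset.disjoint_left]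
      intro e he he'
      simp only [Finset.mem_insert, Finset.mem_singleton] at he
      simp only [Finset.mem_union, Finset.mem_image] at he'
      rcases he' with ⟨l, hl, rfl⟩ | ⟨l, hl, rfl⟩
      · rcases he with he | he
        · exact hk (ha (hks l hl) hkk he ▸ hl)
        · exact hab l (hks l hl) k hkk he
      · rcases he with he | he
        · exact hab k hkk l (hks l hl) he.symm
        · exact hk (hb (hks l hl) hkk he ▸ hl)
    have hpair := hind.indepFun_finset _ _ hdisj (measurable_coinNoise P)
    let f : (({a k, b k} : Finset ε) → ℝ) → ℝ := fun v => v ⟨a k, by simp⟩ * v ⟨b k, by simp⟩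
    -- The old sum as a function of its own coins only, none of which belongs to the new pair.
    let g : ((s.image a ∪ s.image b : Finset ε) → ℝ) → ℝ := fun v =>
      ∑ l ∈ s.attach, v ⟨a l, Finset.mem_union_left _ (Finset.mem_image_of_mem a l.2)⟩ *
        v ⟨b l, Finset.mem_union_right _ (Finset.mem_image_of_mem b l.2)⟩
    have hf : Measurable f := by fun_prop
    have hg : Measurable g := by fun_prop
    have hcomp := hpair.comp hf hg
    have hgs : (fun ω => ∑ l ∈ s, coinNoise P (a l) ω * coinNoise P (b l) ω) =
        g ∘ fun ω e => coinNoise P e ω := funext fun ω =>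
      (Finset.sum_attach s fun l => coinNoise P (a l) ω * coinNoise P (b l) ω).symm
    have hindep : IndepFun (fun ω => coinNoise P (a k) ω * coinNoise P (b k) ω)
        (fun ω => ∑ l ∈ s, coinNoise P (a l) ω * coinNoise P (b l) ω) (coinMeasure P) := by
      rw [hgs]; exact hcomp
    have := h1.add_of_indepFun ih' hindep
    rw [Finset.card_insert_of_notMem hk, Nat.cast_add, Nat.cast_one, add_comm]
    simpa [Finset.sum_insert hk] using this

end Concentration

/-! ### Conditional law of the graph and concentration of its noise. -/

section GraphLaw

variable {n : ℕ}

/-- The coin that decides about the edge `ij`. -/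
def orderedPair (i j : Fin n) : Fin n × Fin n := if j < i then (i, j) else (j, i)

theorem orderedPair_comm (i j : Fin n) : orderedPair i j = orderedPair j i := by
  unfold orderedPair
  rcases lt_trichotomy i j with h | rfl | h
  · simp [h, h.not_gt]
  · rfl
  · simp [h, h.not_gt]

theorem orderedPair_eq_iff {i j k l : Fin n} :
    orderedPair i j = orderedPair k l ↔ (i = k ∧ j = l) ∨ (i = l ∧ j = k) := by
  unfold orderedPair
  split_ifs <;> simp only [Prod.mk.injEq] <;> omega

/-- The graph with edges decided by coins. -/
def coinGraph (ω : Fin n × Fin n → Bool) : SimpleGraph (Fin n) where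
  Adj i j := i ≠ j ∧ ω (orderedPair i j) = true
  symm := ⟨fun i j h => ⟨h.1.symm, by rw [orderedPair_comm]; exact h.2⟩⟩
  loopless := ⟨fun _ h => h.1 rfl⟩

theorem coinGraph_eq_iff (ω : Fin n × Fin n → Bool) (G : SimpleGraph (Fin n)) :
    coinGraph ω = G ↔ ∀ i j, j < i → (ω (i, j) = true ↔ G.Adj i j) := by
  constructor
  · rintro rfl i j hij
    simp [coinGraph, orderedPair, hij, hij.ne']
  · intro h
    ext i j
    rcases lt_trichotomy i j with hij | rfl | hij
    · simp [coinGraph, orderedPair, hij.not_gt, hij.ne, h j i hij, G.adj_comm]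
    · simp
    · simp [coinGraph, orderedPair, hij, hij.ne', h i j hij]

variable {ι : Type*} [Fintype ι]

/-- The edge likelihood is the law of the graph decided by independent coins. -/
theorem coinMeasure_coinGraph_eq {P : Fin n × Fin n → unitInterval}
    {x : Fin n → EuclideanSpace ℝ ι} (hP : ∀ i j, (P (i, j) : ℝ) = inner ℝ (x i) (x j))
    (G : SimpleGraph (Fin n)) :
    coinMeasure P {ω | coinGraph ω = G} = ENNReal.ofReal (edgeLikelihood x G) := by
  classical
  -- The event is a box: one coin is prescribed for each `j < i`, and the other coins are free.
  have hset : {ω : Fin n × Fin n → Bool | coinGraph ω = G} = Set.pi Set.univ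
      fun e : Fin n × Fin n => if e.2 < e.1 then {decide (G.Adj e.1 e.2)} else Set.univ := by
    ext ω
    rw [Set.mem_ofPred_eq, coinGraph_eq_iff, Set.mem_univ_pi]
    constructor
    · rintro h ⟨i, j⟩
      dsimp only
      split_ifs with hij
      · rw [Set.mem_singleton_iff, Bool.eq_iff_iff, decide_eq_true_iff]
        exact h i j hij
      · trivial
    · intro h i j hij
      have := h (i, j)
      by_cases hG : G.Adj i j <;> simp_all
  rw [hset, coinMeasure, Measure.pi_pi, Fintype.prod_prod_type, edgeLikelihood]
  have hnn : ∀ i j, (0 : ℝ) ≤ if G.Adj i j then inner ℝ (x i) (x j) else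
      1 - inner ℝ (x i) (x j) := fun i j => by
    have := (P (i, j)).2
    rw [hP] at this
    split_ifs
    · exact this.1
    · linarith [this.2]
  rw [ENNReal.ofReal_prod_of_nonneg fun i _ => Finset.prod_nonneg fun j _ => hnn i j]
  refine Finset.prod_congr rfl fun i _ => ?_
  rw [ENNReal.ofReal_prod_of_nonneg fun j _ => hnn i j, Finset.prod_filter]
  refine Finset.prod_congr rfl fun j _ => ?_
  dsimp only
  split_ifs with hij hG
  · rw [bernoulliMeasure_apply_of_mem_of_notMem _ (by measurability) (by simp [hG])
      (by simp [hG]), ← hP, ENNReal.ofReal]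
    congr 1
    ext
    simp [(P (i, j)).2.1]
  · rw [bernoulliMeasure_apply_of_notMem_of_mem _ (by measurability) (by simp [hG])
      (by simp [hG]), ← hP, ENNReal.ofReal]
    congr 1
    ext
    simp [(P (i, j)).2.2]
  · simp

/-- Given the latent positions, the graph is decided by independent coins. -/
theorem IsRDPG.measure_eq_and_mem_le {Ω : Type*} [MeasurableSpace Ω]
    {F : Measure (EuclideanSpace ℝ ι)} {μ : Measure Ω} {X : Fin n → Ω → EuclideanSpace ℝ ι}
    {A : Ω → SimpleGraph (Fin n)} (h : IsRDPG F μ X A) {P : Fin n × Fin n → unitInterval}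
    {x : Fin n → EuclideanSpace ℝ ι} (hP : ∀ i j, (P (i, j) : ℝ) = inner ℝ (x i) (x j))
    (S : Set (SimpleGraph (Fin n))) :
    μ {ω | (fun i => X i ω) = x ∧ A ω ∈ S} ≤
      μ {ω | (fun i => X i ω) = x} * coinMeasure P {ω | coinGraph ω ∈ S} := by
  classical
  have hfin : Fintype (SimpleGraph (Fin n)) := Fintype.ofFinite _
  set T : Finset (SimpleGraph (Fin n)) := Finset.univ.filter fun G => G ∈ S
  have hone : ∀ G, μ {ω | (fun i => X i ω) = x ∧ A ω = G} =
      μ {ω | (fun i => X i ω) = x} * coinMeasure P {ω | coinGraph ω = G} := fun G => by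
    -- On the event `X = x` the edge likelihood is constant.
    have h1 := h.conditional_law {x} (measurableSet_singleton x) G
    simp only [Set.mem_singleton_iff] at h1
    rw [h1, coinMeasure_coinGraph_eq hP]
    have hmeas : MeasurableSet {ω | (fun i => X i ω) = x} :=
      (measurable_pi_lambda _ h.measurable_position) (measurableSet_singleton x)
    rw [setLIntegral_congr_fun hmeas
      (g := fun _ => ENNReal.ofReal (edgeLikelihood x G)), setLIntegral_const, mul_comm]
    intro ω hω
    simp only [Set.mem_ofPred_eq] at hω
    simp only [hω]
  calc μ {ω | (fun i => X i ω) = x ∧ A ω ∈ S}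
      ≤ μ (⋃ G ∈ T, {ω | (fun i => X i ω) = x ∧ A ω = G}) := by
        refine measure_mono fun ω hω => ?_
        simp only [Set.mem_iUnion]
        exact ⟨A ω, by simpa [T] using hω.2, hω.1, rfl⟩
    _ ≤ ∑ G ∈ T, μ {ω | (fun i => X i ω) = x ∧ A ω = G} := measure_biUnion_finset_le _ _
    _ = μ {ω | (fun i => X i ω) = x} * ∑ G ∈ T, coinMeasure P {ω | coinGraph ω = G} := by
        rw [Finset.mul_sum]; exact Finset.sum_congr rfl fun G _ => hone G
    _ = _ := by
        congr 1
        rw [← measure_biUnion_finset]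
        · congr 1
          ext ω
          simp [T]
        · intro G _ G' _ hne
          rw [Function.onFun, Set.disjoint_left]
          rintro ω rfl h'
          exact hne h'
        · exact fun G _ => (Set.toFinite _).measurableSet

theorem edgeNoise_coinGraph {P : Fin n × Fin n → unitInterval}
    {x : Fin n → EuclideanSpace ℝ ι} (hP : ∀ i j, (P (i, j) : ℝ) = inner ℝ (x i) (x j))
    (ω : Fin n × Fin n → Bool) {i j : Fin n} (hij : i ≠ j) :
    edgeNoise x (coinGraph ω) i j = coinNoise P (orderedPair i j) ω := by
  classical
  have h1 : (P (orderedPair i j) : ℝ) = inner ℝ (x i) (x j) := by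
    unfold orderedPair
    split_ifs
    · exact hP i j
    · rw [hP, real_inner_comm]
  rw [edgeNoise, coinNoise, adjacency_apply, h1]
  simp [coinGraph, hij]

theorem unitInterval_gram_mem {P : Fin n × Fin n → unitInterval}
    {x : Fin n → EuclideanSpace ℝ ι} (hP : ∀ i j, (P (i, j) : ℝ) = inner ℝ (x i) (x j))
    (i j : Fin n) : inner ℝ (x i) (x j) ∈ Set.Icc (0 : ℝ) 1 := by
  rw [← hP]; exact (P (i, j)).2

/-- Concentration of the entries of the square of the noise. -/
theorem coinMeasure_sq_noise_le {P : Fin n × Fin n → unitInterval}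
    {x : Fin n → EuclideanSpace ℝ ι} (hP : ∀ i j, (P (i, j) : ℝ) = inner ℝ (x i) (x j))
    {δ : ℝ} (hδ : 0 < δ) (hn : 4 ≤ δ * n) {i j : Fin n} (hij : i ≠ j) :
    (coinMeasure P).real {ω | δ * n < |∑ k, edgeNoise x (coinGraph ω) k i *
      edgeNoise x (coinGraph ω) k j|} ≤ 2 * Real.exp (-(δ ^ 2 / 8) * n) := by
  classical
  have hn0 : (0 : ℝ) < n := by have : 0 < n := i.pos; exact_mod_cast this
  have hX := unitInterval_gram_mem hP
  -- For `k = i` or `k = j` a diagonal entry of the noise appears, which is not a coin. For the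
  -- other `k` the coins `ki`, `kj` are pairwise different.
  set s : Finset (Fin n) := (Finset.univ.erase i).erase j with hs
  have hmem : ∀ k, k ∈ s ↔ k ≠ j ∧ k ≠ i := fun k => by simp [hs]
  have hsub : HasSubgaussianMGF (fun ω => ∑ k ∈ s, coinNoise P (orderedPair k i) ω *
      coinNoise P (orderedPair k j) ω) n (coinMeasure P) := by
    refine (hasSubgaussianMGF_sum_coinNoise_mul P s ?_ ?_ ?_).of_le ?_
    · intro k hk l hl hkl
      have h1 := (hmem k).1 hk
      rcases orderedPair_eq_iff.1 hkl with h | h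
      · exact h.1
      · exact absurd h.1 h1.2
    · intro k hk l hl hkl
      have h1 := (hmem k).1 hk
      rcases orderedPair_eq_iff.1 hkl with h | h
      · exact h.1
      · exact absurd h.1 h1.1
    · intro k hk l hl hkl
      have h1 := (hmem k).1 hk
      rcases orderedPair_eq_iff.1 hkl with h | h
      · exact hij h.2
      · exact h1.1 h.1
    · have : s.card ≤ n := (Finset.card_le_univ s).trans (by simp)
      exact_mod_cast this
  -- The two omitted terms are at most `2 ≤ δ n / 2`, so half the threshold remains, and `(δ n / 2)²
  -- / (2 n) = δ² n / 8`.
  have htail := hsub.measureReal_abs_ge_le (t := δ * n / 2) (by positivity)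
  refine (measureReal_mono ?_).trans (htail.trans (le_of_eq ?_))
  · intro ω hω
    simp only [Set.mem_ofPred_eq] at hω ⊢
    have hE : ∀ a b, |edgeNoise x (coinGraph ω) a b| ≤ 1 := fun a b => abs_edgeNoise_le (hX a b)
    have h1 : ∑ k ∈ s, coinNoise P (orderedPair k i) ω * coinNoise P (orderedPair k j) ω =
        ∑ k ∈ s, edgeNoise x (coinGraph ω) k i * edgeNoise x (coinGraph ω) k j :=
      Finset.sum_congr rfl fun k hk => by
        rw [edgeNoise_coinGraph hP ω ((hmem k).1 hk).2, edgeNoise_coinGraph hP ω ((hmem k).1 hk).1]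
    rw [h1]
    have h2 := Finset.add_sum_erase Finset.univ (fun k => edgeNoise x (coinGraph ω) k i *
      edgeNoise x (coinGraph ω) k j) (Finset.mem_univ i)
    have h3 := Finset.add_sum_erase (Finset.univ.erase i) (fun k => edgeNoise x (coinGraph ω) k i *
      edgeNoise x (coinGraph ω) k j) (a := j) (by simp [hij.symm])
    rw [← h2, ← h3] at hω
    have hb : ∀ k, |edgeNoise x (coinGraph ω) k i * edgeNoise x (coinGraph ω) k j| ≤ 1 :=
      fun k => by rw [abs_mul]; exact mul_le_one₀ (hE k i) (abs_nonneg _) (hE k j)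
    have h4 := (abs_add_le _ _).trans (add_le_add (hb i) ((abs_add_le _ _).trans
      (add_le_add (hb j) (le_refl |∑ k ∈ s, edgeNoise x (coinGraph ω) k i *
        edgeNoise x (coinGraph ω) k j|))))
    linarith
  · congr 2
    push_cast
    field_simp
    ring

/-- Concentration of linear functions of the rows of the noise. -/
theorem coinMeasure_linear_noise_le {P : Fin n × Fin n → unitInterval}
    {x : Fin n → EuclideanSpace ℝ ι} (hP : ∀ i j, (P (i, j) : ℝ) = inner ℝ (x i) (x j))
    {δ : ℝ} (hδ : 0 < δ) (hn : 2 ≤ δ * n) (i : Fin n) (s : Finset (Fin n)) {c : Fin n → ℝ}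
    (hc : ∀ k, |c k| ≤ 1) :
    (coinMeasure P).real {ω | δ * n < |∑ k ∈ s, edgeNoise x (coinGraph ω) i k * c k|} ≤
      2 * Real.exp (-(δ ^ 2 / 8) * n) := by
  classical
  have hn0 : (0 : ℝ) < n := by have : 0 < n := i.pos; exact_mod_cast this
  have hX := unitInterval_gram_mem hP
  have hinj : Function.Injective fun k : Fin n => orderedPair i k := fun k l hkl => by
    rcases orderedPair_eq_iff.1 hkl with h | h
    · exact h.2
    · exact h.2.trans h.1
  have hsub := hasSubgaussianMGF_sum_coinNoise P hinj hc (s.erase i) (n := n)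
    ((Finset.card_le_univ _).trans (by simp))
  have htail := hsub.measureReal_abs_ge_le (t := δ * n / 2) (by positivity)
  refine (measureReal_mono ?_).trans (htail.trans (le_of_eq ?_))
  · intro ω hω
    simp only [Set.mem_ofPred_eq] at hω ⊢
    have h1 : ∑ k ∈ s.erase i, c k * coinNoise P (orderedPair i k) ω =
        ∑ k ∈ s.erase i, edgeNoise x (coinGraph ω) i k * c k :=
      Finset.sum_congr rfl fun k hk => by
        rw [edgeNoise_coinGraph hP ω (Finset.ne_of_mem_erase hk).symm, mul_comm]
    rw [h1]
    by_cases hi : i ∈ s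
    · rw [← Finset.add_sum_erase s _ hi] at hω
      have hb : |edgeNoise x (coinGraph ω) i i * c i| ≤ 1 := by
        rw [abs_mul]; exact mul_le_one₀ (abs_edgeNoise_le (hX i i)) (abs_nonneg _) (hc i)
      have h4 := (abs_add_le _ _).trans (add_le_add hb
        (le_refl |∑ k ∈ s.erase i, edgeNoise x (coinGraph ω) i k * c k|))
      linarith
    · rw [Finset.erase_eq_of_notMem hi]
      linarith
  · congr 2
    push_cast
    field_simp
    ring

end GraphLaw

/-! ### Typical noise and typical block counts. -/

section GoodEvent

variable {n : ℕ} {ι κ : Type*} [Fintype ι] [Fintype κ]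

/-- The noise has a square with small off-diagonal entries, and small sums against the latent
positions of the vertices in each `S r`. -/
def NoiseBounded (δ : ℝ) (S : κ → Finset (Fin n)) (x : Fin n → EuclideanSpace ℝ ι)
    (G : SimpleGraph (Fin n)) : Prop :=
  (∀ i j, i ≠ j → |∑ k, edgeNoise x G k i * edgeNoise x G k j| ≤ δ * n) ∧
    ∀ i r a, |∑ k ∈ S r, edgeNoise x G i k * x k a| ≤ δ * n

theorem abs_coord_le_of_inner_self_le_one {v : EuclideanSpace ℝ ι} (hv : inner ℝ v v ≤ (1 : ℝ))
    (a : ι) : |v a| ≤ 1 := by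
  rw [real_inner_self_eq_norm_sq] at hv
  have h1 : ‖v‖ ≤ 1 := by nlinarith [norm_nonneg v]
  exact (PiLp.norm_apply_le v a).trans h1

theorem coinMeasure_not_noiseBounded_le {P : Fin n × Fin n → unitInterval}
    {x : Fin n → EuclideanSpace ℝ ι} (hP : ∀ i j, (P (i, j) : ℝ) = inner ℝ (x i) (x j))
    {δ : ℝ} (hδ : 0 < δ) (hn : 4 ≤ δ * n) (S : κ → Finset (Fin n)) :
    (coinMeasure P).real {ω | ¬ NoiseBounded δ S x (coinGraph ω)} ≤
      (n ^ 2 + n * (Fintype.card κ * Fintype.card ι)) *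
        (2 * Real.exp (-(δ ^ 2 / 8) * n)) := by
  classical
  have hsub : {ω | ¬ NoiseBounded δ S x (coinGraph ω)} ⊆
      (⋃ p : Fin n × Fin n, {ω | p.1 ≠ p.2 ∧ δ * n < |∑ k, edgeNoise x (coinGraph ω) k p.1 *
        edgeNoise x (coinGraph ω) k p.2|}) ∪
      ⋃ q : Fin n × κ × ι,
        {ω | δ * n < |∑ k ∈ S q.2.1, edgeNoise x (coinGraph ω) q.1 k * x k q.2.2|} := by
    intro ω hω
    simp only [Set.mem_ofPred_eq, NoiseBounded, not_and_or] at hω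
    push Not at hω
    rcases hω with ⟨i, j, hij, h⟩ | ⟨i, r, a, h⟩
    · exact Or.inl (Set.mem_iUnion.2 ⟨(i, j), hij, h⟩)
    · exact Or.inr (Set.mem_iUnion.2 ⟨(i, r, a), h⟩)
  refine (measureReal_mono hsub).trans ((measureReal_union_le _ _).trans ?_)
  rw [add_mul]
  refine add_le_add ((measureReal_iUnion_fintype_le _).trans ?_)
    ((measureReal_iUnion_fintype_le _).trans ?_)
  · have : ∀ p : Fin n × Fin n, (coinMeasure P).real {ω | p.1 ≠ p.2 ∧ δ * n <
        |∑ k, edgeNoise x (coinGraph ω) k p.1 * edgeNoise x (coinGraph ω) k p.2|} ≤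
        2 * Real.exp (-(δ ^ 2 / 8) * n) := fun p => by
      by_cases hp : p.1 = p.2
      · simp only [hp, ne_eq, not_true_eq_false, false_and]
        have : {ω : Fin n × Fin n → Bool | False} = ∅ := by ext; simp
        rw [this, measureReal_empty]
        positivity
      · refine (measureReal_mono fun ω hω => ?_).trans (coinMeasure_sq_noise_le hP hδ hn hp)
        exact hω.2
    refine (Finset.sum_le_card_nsmul _ _ _ fun p _ => this p).trans (le_of_eq ?_)
    rw [nsmul_eq_mul]
    simp [pow_two]
  · refine (Finset.sum_le_card_nsmul _ _ _ fun q _ =>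
      coinMeasure_linear_noise_le hP hδ (by linarith) q.1 (S q.2.1) (c := fun k => x k q.2.2)
        fun k => abs_coord_le_of_inner_self_le_one (unitInterval_gram_mem hP k k).2 _).trans
      (le_of_eq ?_)
    rw [nsmul_eq_mul]
    simp

/-- Concentration of the noise of a random dot product graph with finitely many latent
positions. -/
theorem IsRDPG.measureReal_not_noiseBounded_le {Ω : Type*} [MeasurableSpace Ω]
    {F : Measure (EuclideanSpace ℝ ι)} {μ : Measure Ω} [IsProbabilityMeasure μ]
    {X : Fin n → Ω → EuclideanSpace ℝ ι}
    {A : Ω → SimpleGraph (Fin n)} (h : IsRDPG F μ X A) (T : Finset (EuclideanSpace ℝ ι))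
    (hT : ∀ x ∈ T, ∀ y ∈ T, inner ℝ x y ∈ Set.Icc (0 : ℝ) 1)
    {δ : ℝ} (hδ : 0 < δ) (hn : 4 ≤ δ * n)
    (S : (Fin n → EuclideanSpace ℝ ι) → κ → Finset (Fin n)) :
    μ.real {ω | (∀ i, X i ω ∈ T) ∧
        ¬ NoiseBounded δ (S fun i => X i ω) (fun i => X i ω) (A ω)} ≤
      (n ^ 2 + n * (Fintype.card κ * Fintype.card ι)) *
        (2 * Real.exp (-(δ ^ 2 / 8) * n)) := by
  classical
  set b : ℝ := (n ^ 2 + n * (Fintype.card κ * Fintype.card ι)) *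
    (2 * Real.exp (-(δ ^ 2 / 8) * n)) with hb
  -- There are exponentially many configurations, but the conditional bound `b` is the same for all
  -- of them and their probabilities add up to at most `1`.
  set U : Finset (Fin n → EuclideanSpace ℝ ι) := Fintype.piFinset fun _ => T
  have hone : ∀ x ∈ U, μ.real {ω | (fun i => X i ω) = x ∧ ¬ NoiseBounded δ (S x) x (A ω)} ≤
      μ.real {ω | (fun i => X i ω) = x} * b := fun x hx => by
    have hxT : ∀ i, x i ∈ T := fun i => Fintype.mem_piFinset.1 hx i
    let P : Fin n × Fin n → unitInterval := fun e =>
      ⟨inner ℝ (x e.1) (x e.2), hT _ (hxT e.1) _ (hxT e.2)⟩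
    have hP : ∀ i j, (P (i, j) : ℝ) = inner ℝ (x i) (x j) := fun i j => rfl
    have h1 := h.measure_eq_and_mem_le hP {G | ¬ NoiseBounded δ (S x) x G}
    have h2 := ENNReal.toReal_mono (by finiteness) h1
    rw [ENNReal.toReal_mul] at h2
    refine h2.trans (mul_le_mul_of_nonneg_left ?_ ENNReal.toReal_nonneg)
    exact coinMeasure_not_noiseBounded_le hP hδ hn (S x)
  have hsub : {ω | (∀ i, X i ω ∈ T) ∧
      ¬ NoiseBounded δ (S fun i => X i ω) (fun i => X i ω) (A ω)} ⊆
      ⋃ x ∈ U, {ω | (fun i => X i ω) = x ∧ ¬ NoiseBounded δ (S x) x (A ω)} := by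
    intro ω hω
    simp only [Set.mem_iUnion]
    exact ⟨fun i => X i ω, Fintype.mem_piFinset.2 hω.1, rfl, hω.2⟩
  refine (measureReal_mono hsub (measure_ne_top _ _)).trans ((measureReal_biUnion_finset_le _ _).trans
    ((Finset.sum_le_sum hone).trans ?_))
  rw [← Finset.sum_mul, ← measureReal_biUnion_finset]
  · refine mul_le_of_le_one_left (by positivity) measureReal_le_one
  · intro x _ y _ hne
    rw [Function.onFun, Set.disjoint_left]
    rintro ω rfl h'
    exact hne h'
  · exact fun x _ => (measurable_pi_lambda _ h.measurable_position) (measurableSet_singleton x)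

/-- A value of positive probability is taken by a positive proportion of the vertices. -/
theorem IsRDPG.measureReal_count_lt_le {Ω : Type*} [MeasurableSpace Ω]
    {F : Measure (EuclideanSpace ℝ ι)} {μ : Measure Ω} [IsProbabilityMeasure μ]
    {X : Fin n → Ω → EuclideanSpace ℝ ι}
    {A : Ω → SimpleGraph (Fin n)} (h : IsRDPG F μ X A) {x : EuclideanSpace ℝ ι} {w : ℝ}
    (hw : 0 < w) (hF : w ≤ F.real {x}) (hn : 0 < n) [DecidableEq (EuclideanSpace ℝ ι)] :
    μ.real {ω | ((Finset.univ.filter fun i => X i ω = x).card : ℝ) < w / 2 * n} ≤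
      Real.exp (-(w ^ 2 / 8) * n) := by
  have hn' : (0 : ℝ) < n := by exact_mod_cast hn
  set p := F.real {x} with hp
  have hF1 : ∀ i, μ.real (X i ⁻¹' {x}) = p := fun i => by
    rw [hp, ← h.law i, map_measureReal_apply (h.measurable_position i) (measurableSet_singleton x)]
  have hp1 : p ≤ 1 := by rw [← hF1 ⟨0, hn⟩]; exact measureReal_le_one
  -- Centred deficit. Since `p ≥ w`, fewer than `w n / 2` hits force the deficits to sum to more
  -- than `w n / 2`.
  let g : EuclideanSpace ℝ ι → ℝ := fun y => p - Set.indicator {x} (fun _ => (1 : ℝ)) y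
  have hg : Measurable g :=
    measurable_const.sub (measurable_const.indicator (measurableSet_singleton x))
  have hind : iIndepFun (fun i ω => g (X i ω)) μ := h.indep.comp (fun _ => g) fun _ => hg
  have hsub : ∀ i, HasSubgaussianMGF (fun ω => g (X i ω)) 1 μ := fun i => by
    refine hasSubgaussianMGF_one_of_abs_le (hg.comp (h.measurable_position i)) (fun ω => ?_) ?_
    · simp only [g, Set.indicator_apply]
      rw [abs_le]
      split_ifs <;> constructor <;> linarith
    · have e : (fun ω => g (X i ω)) =
          fun ω => p - Set.indicator (X i ⁻¹' {x}) (fun _ => (1 : ℝ)) ω := rfl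
      have hm : MeasurableSet (X i ⁻¹' {x}) := h.measurable_position i (measurableSet_singleton x)
      rw [e, integral_sub (integrable_const _) ((integrable_const _).indicator hm),
        integral_indicator_const _ hm, hF1 i]
      simp
  have htail := HasSubgaussianMGF.measure_sum_ge_le_of_iIndepFun hind (c := fun _ => 1)
    (s := Finset.univ) (fun i _ => hsub i) (ε := w / 2 * n) (by positivity)
  refine (measureReal_mono fun ω hω => ?_).trans (htail.trans (le_of_eq ?_))
  · simp only [Set.mem_ofPred_eq] at hω ⊢
    have h1 : ∑ i, g (X i ω) = n * p - (Finset.univ.filter fun i => X i ω = x).card := by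
      simp only [g, Finset.sum_sub_distrib, Set.indicator_apply, Set.mem_singleton_iff,
        Finset.sum_const, Finset.card_univ, Fintype.card_fin, nsmul_eq_mul, Finset.sum_boole]
    rw [h1]
    nlinarith
  · congr 1
    simp
    field_simp
    ring

end GoodEvent

/-! ### Asymptotics and choice of the noise level. -/

section Assembly

theorem AsympAlmostSurely.mono {Ω : ℕ → Type*} [∀ n, MeasurableSpace (Ω n)]
    {μ : ∀ n, Measure (Ω n)} [∀ n, IsProbabilityMeasure (μ n)] {E E' : ∀ n, Set (Ω n)}
    (h : AsympAlmostSurely μ E) (hE : ∀ n, E n ⊆ E' n) : AsympAlmostSurely μ E' := by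
  intro c hc
  obtain ⟨n₀, h⟩ := h c hc
  exact ⟨n₀, fun n hn η h1 h2 => (h n hn η h1 h2).trans
    (measureReal_mono (hE n) (measure_ne_top _ _))⟩

/-- Turns a failure probability `C n² exp(-b n)` into an asymptotically almost sure event, as
admissible `η` exceed `n ^ (-c)`. -/
theorem exists_mul_sq_mul_exp_le (C : ℝ) {b c : ℝ} (hb : 0 < b) :
    ∃ n₀ : ℕ, ∀ n : ℕ, n₀ < n → C * n ^ 2 * Real.exp (-b * n) ≤ (n : ℝ) ^ (-c) := by
  have h := (isLittleO_exp_neg_mul_rpow_atTop hb (-c - 2)).bound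
    (show (0 : ℝ) < 1 / (|C| + 1) by positivity)
  have h' := (tendsto_natCast_atTop_atTop (R := ℝ)).eventually h
  obtain ⟨n₀, hn₀⟩ := Filter.eventually_atTop.1 h'
  refine ⟨n₀, fun n hn => ?_⟩
  have hn' : (0 : ℝ) < n := by
    have : 0 < n := by omega
    exact_mod_cast this
  have h1 := hn₀ n hn.le
  rw [Real.norm_of_nonneg (Real.exp_pos _).le,
    Real.norm_of_nonneg (Real.rpow_nonneg hn'.le _)] at h1
  have h2 : (n : ℝ) ^ 2 * (n : ℝ) ^ (-c - 2) = (n : ℝ) ^ (-c) := by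
    rw [← Real.rpow_natCast, ← Real.rpow_add hn']
    congr 1
    push_cast
    ring
  calc C * n ^ 2 * Real.exp (-b * n) ≤ |C| * n ^ 2 * (1 / (|C| + 1) * (n : ℝ) ^ (-c - 2)) := by
        gcongr
        exact le_abs_self C
    _ = |C| / (|C| + 1) * ((n : ℝ) ^ 2 * (n : ℝ) ^ (-c - 2)) := by ring
    _ ≤ 1 * (n : ℝ) ^ (-c) := by
        rw [h2]
        gcongr
        rw [div_le_one (by positivity)]
        linarith
    _ = _ := one_mul _

theorem exists_pos_forall_le {κ : Type*} [Finite κ] {f : κ → ℝ} (hf : ∀ k, 0 < f k) :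
    ∃ m : ℝ, 0 < m ∧ ∀ k, m ≤ f k := by
  rcases isEmpty_or_nonempty κ with h | h
  · exact ⟨1, one_pos, fun k => h.elim k⟩
  · obtain ⟨k, hk⟩ := Finite.exists_min f
    exact ⟨f k, hf k, hk⟩

variable {ι : Type*} [Fintype ι] {n : ℕ}

/-- For a sufficiently small noise level, spectral embeddings of induced subgraphs recover the Gram
matrix up to `τ`. -/
theorem exists_noise_level {l τ : ℝ} (hl : 0 < l) (hτ : 0 < τ) :
    ∃ δ : ℝ, 0 < δ ∧ ∃ N : ℕ, ∀ (n : ℕ), N ≤ n → ∀ (κ : Type) (S : κ → Finset (Fin n))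
      (X : Fin n → EuclideanSpace ℝ ι) (G : SimpleGraph (Fin n)), NoiseBounded δ S X G →
      (∀ i j, inner ℝ (X i) (X j) ∈ Set.Icc (0 : ℝ) 1) →
      ∀ (r : κ) (V : Type) [Fintype V] [DecidableEq V] (e : V → Fin n),
      Function.Injective e → (∀ i, i ∈ S r ↔ i ∈ Set.range e) →
      ∀ (W : Submodule ℝ (EuclideanSpace ℝ ι)) (hW : ∀ a, X (e a) ∈ W),
      (∀ v : W, l * n * ‖v‖ ^ 2 ≤ ∑ a, inner ℝ (⟨X (e a), hW a⟩ : W) v ^ 2) →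
      ∀ (m : ℕ), Module.finrank ℝ W = m → ∀ (Xhat : V → EuclideanSpace ℝ (Fin m)),
      IsASE ((adjacency G).submatrix e e) Xhat →
      ∀ a b, |inner ℝ (Xhat a) (Xhat b) - inner ℝ (X (e a)) (X (e b))| ≤ τ := by
  classical
  set D : ℝ := 8 / l ^ 2 + 3 / l with hD
  have hD0 : 0 < D := by positivity
  -- `δ₁` is the level required of the operator norm and the row sums. The level `δ` bounds entries
  -- of the square of the noise, hence `δ₁² / 2`, and single coordinates of the row sums, hence the
  -- division by `card ι + 1`.
  set δ₁ : ℝ := min (l / 4) (τ / D) with hδ₁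
  have hδ₁0 : 0 < δ₁ := by positivity
  set δ : ℝ := min (δ₁ ^ 2 / 2) (δ₁ / (Fintype.card ι + 1)) with hδ
  have hδ0 : 0 < δ := by positivity
  obtain ⟨N, hN⟩ := exists_nat_ge (1 / (δ₁ ^ 2 / 2))
  refine ⟨δ, hδ0, N, ?_⟩
  intro n hn κ S X G hnoise hX r V _ _ e he hS W hW hlow m hm Xhat hASE a b
  have hn' : (N : ℝ) ≤ n := by exact_mod_cast hn
  have hmain := hASE.abs_inner_sub_inner_le_of_edgeNoise hm he (fun a => (⟨X (e a), hW a⟩ : W))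
    (fun a b => rfl) hX hl hδ₁0 (min_le_left _ _) ?_ hlow ?_ ?_ a b
  · refine hmain.trans ?_
    calc D * δ₁ ≤ D * (τ / D) := by gcongr; exact min_le_right _ _
      _ = τ := by field_simp
  · have h1 := hN.trans hn'
    rw [div_le_iff₀ (by positivity)] at h1
    linarith
  · intro i j hij
    refine (hnoise.1 i j hij).trans ?_
    gcongr
    exact min_le_left _ _
  · intro a
    have hsum : ∀ f : Fin n → EuclideanSpace ℝ ι, ∑ b, f (e b) = ∑ k ∈ S r, f k := fun f => by
      have : S r = Finset.univ.image e := by ext i; rw [hS]; simp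
      rw [this, Finset.sum_image fun a _ b _ hab => he hab]
    rw [hsum fun k => edgeNoise X G (e a) k • X k]
    have hcoord : ∀ c, |(∑ k ∈ S r, edgeNoise X G (e a) k • X k) c| ≤ δ * n := fun c => by
      have := hnoise.2 (e a) r c
      simpa [WithLp.ofLp_sum, Finset.sum_apply] using this
    refine le_of_sq_le_sq ?_ (by positivity)
    rw [EuclideanSpace.norm_sq_eq]
    have h1 : ∀ c ∈ (Finset.univ : Finset ι),
        ‖(∑ k ∈ S r, edgeNoise X G (e a) k • X k) c‖ ^ 2 ≤ (δ * n) ^ 2 := fun c _ =>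
      pow_le_pow_left₀ (norm_nonneg _) (hcoord c) 2
    refine (Finset.sum_le_card_nsmul _ _ _ h1).trans ?_
    rw [nsmul_eq_mul, Finset.card_univ]
    have h2 : δ * (Fintype.card ι + 1) ≤ δ₁ := by
      have := min_le_right (δ₁ ^ 2 / 2) (δ₁ / (Fintype.card ι + 1))
      rwa [← hδ, le_div_iff₀ (by positivity)] at this
    calc (Fintype.card ι : ℝ) * (δ * n) ^ 2 ≤ (Fintype.card ι + 1) ^ 2 * (δ * n) ^ 2 := by
          gcongr
          nlinarith [Nat.cast_nonneg (α := ℝ) (Fintype.card ι)]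
      _ = (δ * (Fintype.card ι + 1) * n) ^ 2 := by ring
      _ ≤ (δ₁ * n) ^ 2 := by gcongr

end Assembly

/-! ### The block model: spanning positions, dimensions, typical samples. -/

section BlockModel

variable {R K : ℕ} {ι : Type*} [Fintype ι]

theorem hsbmLaw_apply (π : Fin R → ℝ) (πs : Fin R → Fin K → ℝ)
    (x : Fin R → Fin K → EuclideanSpace ℝ ι) (s : Set (EuclideanSpace ℝ ι)) :
    hsbmLaw π πs x s = ∑ r, ENNReal.ofReal (π r) *
      ∑ k, ENNReal.ofReal (πs r k) * Measure.dirac (x r k) s := by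
  simp [hsbmLaw, Measure.finsetSum_apply]

/-- Only a lower bound, since blocks may share a latent position. -/
theorem le_hsbmLaw_singleton (π : Fin R → ℝ) (πs : Fin R → Fin K → ℝ)
    (x : Fin R → Fin K → EuclideanSpace ℝ ι) (r : Fin R) (k : Fin K) :
    ENNReal.ofReal (π r) * ENNReal.ofReal (πs r k) ≤ hsbmLaw π πs x {x r k} := by
  rw [hsbmLaw_apply]
  refine le_trans ?_ (Finset.single_le_sum (f := fun r' => ENNReal.ofReal (π r') *
      ∑ k', ENNReal.ofReal (πs r' k') * Measure.dirac (x r' k') {x r k})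
      (fun _ _ => zero_le) (Finset.mem_univ r))
  gcongr
  refine le_trans ?_ (Finset.single_le_sum (f := fun k' =>
    ENNReal.ofReal (πs r k') * Measure.dirac (x r k') {x r k})
      (fun _ _ => zero_le) (Finset.mem_univ k))
  simp

theorem hsbmLaw_compl_eq_zero (π : Fin R → ℝ) (πs : Fin R → Fin K → ℝ)
    (x : Fin R → Fin K → EuclideanSpace ℝ ι) {s : Set (EuclideanSpace ℝ ι)}
    (hs : ∀ r k, x r k ∈ s) : hsbmLaw π πs x sᶜ = 0 := by
  classical
  rw [hsbmLaw_apply]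
  refine Finset.sum_eq_zero fun r _ => ?_
  rw [Finset.sum_eq_zero, mul_zero]
  intro k _
  have : Measure.dirac (x r k) sᶜ = 0 := by
    have h1 : ∀ᵐ y ∂(Measure.dirac (x r k)), y = x r k := by
      rw [ae_dirac_eq]; simp
    refine measure_mono_null (fun y hy => ?_) h1
    intro h2
    exact hy (h2 ▸ hs r k)
  rw [this, mul_zero]

theorem secondMoment_hsbmLaw (π : Fin R → ℝ) (πs : Fin R → Fin K → ℝ)
    (x : Fin R → Fin K → EuclideanSpace ℝ ι) (hπ : ∀ r, 0 < π r) (hπs : ∀ r k, 0 < πs r k)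
    (a b : ι) : secondMoment (hsbmLaw π πs x) a b =
      ∑ r, π r * ∑ k, πs r k * (x r k a * x r k b) := by
  have h_int : ∀ r k, Integrable (fun y : EuclideanSpace ℝ ι => y a * y b)
      (ENNReal.ofReal (πs r k) • Measure.dirac (x r k)) := fun r k =>
    (integrable_dirac enorm_lt_top).smul_measure ENNReal.ofReal_ne_top
  have h_int' : ∀ r, Integrable (fun y : EuclideanSpace ℝ ι => y a * y b)
      (ENNReal.ofReal (π r) • ∑ k, ENNReal.ofReal (πs r k) • Measure.dirac (x r k)) := fun r =>
    (integrable_finsetSum_measure.2 fun k _ => h_int r k).smul_measure ENNReal.ofReal_ne_top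
  rw [secondMoment, Matrix.of_apply, hsbmLaw, integral_finsetSum_measure fun r _ => h_int' r]
  refine Finset.sum_congr rfl fun r _ => ?_
  rw [integral_smul_measure, integral_finsetSum_measure fun k _ => h_int r k,
    ENNReal.toReal_ofReal (hπ r).le, smul_eq_mul]
  congr 1
  refine Finset.sum_congr rfl fun k _ => ?_
  rw [integral_smul_measure, integral_dirac, ENNReal.toReal_ofReal (hπs r k).le, smul_eq_mul]

/-- A vector orthogonal to all latent positions is annihilated by the second moment matrix, which
has trivial kernel. -/
theorem span_eq_top_of_rank_secondMoment (π : Fin R → ℝ) (πs : Fin R → Fin K → ℝ)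
    (x : Fin R → Fin K → EuclideanSpace ℝ ι) (hπ : ∀ r, 0 < π r) (hπs : ∀ r k, 0 < πs r k)
    (hrank : (secondMoment (hsbmLaw π πs x)).rank = Fintype.card ι) :
    Submodule.span ℝ (Set.range fun p : Fin R × Fin K => x p.1 p.2) = ⊤ := by
  classical
  rw [← Submodule.orthogonal_eq_bot_iff, Submodule.eq_bot_iff]
  intro v hv
  have hv0 : ∀ r k, inner ℝ (x r k) v = (0 : ℝ) := fun r k =>
    (Submodule.mem_orthogonal _ _).1 hv _ (Submodule.subset_span ⟨(r, k), rfl⟩)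
  have hmul : (secondMoment (hsbmLaw π πs x)).mulVecLin v.ofLp = 0 := by
    ext a
    simp only [Matrix.mulVecLin_apply, Matrix.mulVec, dotProduct,
      secondMoment_hsbmLaw π πs x hπ hπs, Finset.sum_mul, Pi.zero_apply]
    rw [Finset.sum_comm]
    refine Finset.sum_eq_zero fun r _ => ?_
    have h1 : ∀ k, ∑ b, x r k b * v b = 0 := fun k => by
      have := hv0 r k
      rw [PiLp.inner_apply] at this
      simpa [mul_comm] using this
    calc ∑ b, (π r * ∑ k, πs r k * (x r k a * x r k b)) * v b
        = ∑ b, ∑ k, π r * πs r k * x r k a * (x r k b * v b) := by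
          refine Finset.sum_congr rfl fun b _ => ?_
          rw [Finset.mul_sum, Finset.sum_mul]
          exact Finset.sum_congr rfl fun k _ => by ring
      _ = ∑ k, π r * πs r k * x r k a * ∑ b, x r k b * v b := by
          rw [Finset.sum_comm]
          exact Finset.sum_congr rfl fun k _ => by rw [Finset.mul_sum]
      _ = 0 := Finset.sum_eq_zero fun k _ => by rw [h1, mul_zero]
  have hker : LinearMap.ker (secondMoment (hsbmLaw π πs x)).mulVecLin = ⊥ := by
    have h1 := LinearMap.finrank_range_add_finrank_ker
      (secondMoment (hsbmLaw π πs x)).mulVecLin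
    have h2 : Module.finrank ℝ (LinearMap.range (secondMoment (hsbmLaw π πs x)).mulVecLin) =
        Fintype.card ι := hrank
    rw [h2, Module.finrank_fintype_fun_eq_card] at h1
    exact Submodule.finrank_eq_zero.1 (by omega)
  have h3 : v.ofLp = 0 := by
    have : v.ofLp ∈ LinearMap.ker (secondMoment (hsbmLaw π πs x)).mulVecLin := hmul
    rwa [hker, Submodule.mem_bot] at this
  ext a
  exact congrFun h3 a

/-- If subspaces of dimension at most `d` together span a space of dimension `R d`, each of them
has dimension `d`. -/
theorem finrank_eq_of_iSup_eq_top {E : Type*} [AddCommGroup E] [Module ℝ E]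
    [FiniteDimensional ℝ E] {d : ℕ} (W : Fin R → Submodule ℝ E) (hW : ⨆ r, W r = ⊤)
    (hE : Module.finrank ℝ E = R * d) (hd : ∀ r, Module.finrank ℝ (W r) ≤ d) (r : Fin R) :
    Module.finrank ℝ (W r) = d := by
  -- The sum map is onto, so `R d ≤ ∑ dim W r`; a single dimension below `d` would violate this.
  let f : (∀ r, W r) →ₗ[ℝ] E := ∑ r, (W r).subtype ∘ₗ LinearMap.proj r
  have hf : ∀ v, f v = ∑ r, (v r : E) := fun v => by simp [f]
  have hsurj : LinearMap.range f = ⊤ := by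
    rw [eq_top_iff, ← hW, iSup_le_iff]
    intro r w hw
    classical
    refine ⟨Pi.single r ⟨w, hw⟩, ?_⟩
    rw [hf, Finset.sum_eq_single r]
    · simp
    · intro s _ hs
      simp [Pi.single_eq_of_ne hs]
    · simp
  have h1 := LinearMap.finrank_range_le f
  rw [hsurj, finrank_top, hE, Module.finrank_pi_fintype] at h1
  refine le_antisymm (hd r) ?_
  by_contra hlt
  have h2 : ∑ s, Module.finrank ℝ (W s) < ∑ _s : Fin R, d :=
    Finset.sum_lt_sum (fun s _ => hd s) ⟨r, Finset.mem_univ r, not_le.1 hlt⟩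
  simp at h2
  omega

/-- A typical sample of the block model. -/
structure GoodSample (x : Fin R → Fin K → EuclideanSpace ℝ ι) (w δ : ℝ) (N : ℕ) {n : ℕ}
    (X : Fin n → EuclideanSpace ℝ ι) (G : SimpleGraph (Fin n)) : Prop where
  large : N ≤ n
  mem : ∀ i, ∃ r k, X i = x r k
  count : ∀ r k, ∃ S : Finset (Fin n), (∀ i ∈ S, X i = x r k) ∧ w * n ≤ S.card
  noise : NoiseBounded δ (fun o : Option (Fin R) => o.elim Finset.univ (trueSubgraph x X)) X G

/-- Bad samples are covered by a null event (a value outside the support), rare blocks, and large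
noise. In the noise bound the index `none` stands for the whole graph and `some r` for the `r`-th
subgraph. -/
theorem asympAlmostSurely_goodSample {π : Fin R → ℝ} {πs : Fin R → Fin K → ℝ}
    {x : Fin R → Fin K → EuclideanSpace ℝ ι} {w : ℝ} (hw : 0 < w)
    (hle : ∀ r k, ENNReal.ofReal w ≤ hsbmLaw π πs x {x r k})
    (hx : ∀ r k s l, inner ℝ (x r k) (x s l) ∈ Set.Icc (0 : ℝ) 1)
    {Ω : ℕ → Type*} [∀ n, MeasurableSpace (Ω n)]
    (μ : ∀ n, Measure (Ω n)) [∀ n, IsProbabilityMeasure (μ n)]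
    (X : ∀ n, Fin n → Ω n → EuclideanSpace ℝ ι) (A : ∀ n, Ω n → SimpleGraph (Fin n))
    (h : ∀ n, IsRDPG (hsbmLaw π πs x) (μ n) (X n) (A n)) {δ : ℝ} (hδ : 0 < δ) (N : ℕ) :
    AsympAlmostSurely μ
      (fun n => {ω | GoodSample x (w / 2) δ N (fun i => X n i ω) (A n ω)}) := by
  classical
  intro c hc
  set m : ℝ := Fintype.card (Option (Fin R)) * Fintype.card ι with hm
  set b : ℝ := min (w ^ 2 / 8) (δ ^ 2 / 8) with hb
  have hb0 : 0 < b := by positivity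
  obtain ⟨n₁, hn₁⟩ := exists_mul_sq_mul_exp_le (R * K + 2 * (1 + m)) (c := c) hb0
  obtain ⟨n₂, hn₂⟩ := exists_nat_ge (4 / δ)
  refine ⟨max N (max n₁ n₂), fun n hn η hη _ => ?_⟩
  have hnN : N ≤ n := (le_max_left _ _).trans hn.le
  have hnn₁ : n₁ < n := lt_of_le_of_lt ((le_max_left _ _).trans (le_max_right _ _)) hn
  have hnn₂ : n₂ ≤ n := ((le_max_right _ _).trans (le_max_right _ _)).trans hn.le
  have hn0 : 0 < n := by omega
  have hn1 : (1 : ℝ) ≤ n := by exact_mod_cast hn0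
  have hδn : 4 ≤ δ * n := by
    have h1 : 4 / δ ≤ n := hn₂.trans (by exact_mod_cast hnn₂)
    rw [div_le_iff₀ hδ] at h1
    linarith
  have hF : IsProbabilityMeasure (hsbmLaw π πs x) := by
    rw [← (h n).law ⟨0, hn0⟩]
    exact Measure.isProbabilityMeasure_map ((h n).measurable_position _).aemeasurable
  set T : Finset (EuclideanSpace ℝ ι) :=
    Finset.univ.image fun p : Fin R × Fin K => x p.1 p.2 with hT
  have hTmem : ∀ y, y ∈ T ↔ ∃ r k, y = x r k := fun y => by simp [hT, eq_comm]
  have hTx : ∀ y ∈ T, ∀ z ∈ T, inner ℝ y z ∈ Set.Icc (0 : ℝ) 1 := by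
    intro y hy z hz
    obtain ⟨r, k, rfl⟩ := (hTmem y).1 hy
    obtain ⟨s, l, rfl⟩ := (hTmem z).1 hz
    exact hx r k s l
  set B₀ : Set (Ω n) := ⋃ i, {ω | X n i ω ∉ T}
  set B₁ : Set (Ω n) := ⋃ p : Fin R × Fin K,
    {ω | ((Finset.univ.filter fun i => X n i ω = x p.1 p.2).card : ℝ) < w / 2 * n}
  set B₂ : Set (Ω n) := {ω | (∀ i, X n i ω ∈ T) ∧ ¬ NoiseBounded δ
    (fun o : Option (Fin R) => o.elim Finset.univ (trueSubgraph x fun i => X n i ω))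
    (fun i => X n i ω) (A n ω)}
  have hB₀ : (μ n).real B₀ = 0 := by
    have : (μ n) B₀ = 0 := by
      refine measure_iUnion_null fun i => ?_
      have h1 : (hsbmLaw π πs x) (T : Set (EuclideanSpace ℝ ι))ᶜ = 0 :=
        hsbmLaw_compl_eq_zero π πs x fun r k => by
          rw [Finset.mem_coe, hTmem]; exact ⟨r, k, rfl⟩
      rw [← (h n).law i, Measure.map_apply ((h n).measurable_position i)
        T.measurableSet.compl] at h1
      exact h1
    rw [measureReal_def, this, ENNReal.toReal_zero]
  have hB₁ : (μ n).real B₁ ≤ R * K * Real.exp (-b * n) := by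
    refine (measureReal_iUnion_fintype_le _).trans ?_
    refine (Finset.sum_le_card_nsmul _ _ (Real.exp (-b * n)) fun p _ => ?_).trans (le_of_eq ?_)
    · refine ((h n).measureReal_count_lt_le hw ?_ hn0).trans ?_
      · rw [measureReal_def, ← ENNReal.ofReal_le_iff_le_toReal (measure_ne_top _ _)]
        exact hle p.1 p.2
      · gcongr
        exact min_le_left _ _
    · simp
  have hB₂ : (μ n).real B₂ ≤ 2 * (1 + m) * n ^ 2 * Real.exp (-b * n) := by
    refine ((h n).measureReal_not_noiseBounded_le T hTx hδ hδn
      (fun y (o : Option (Fin R)) => o.elim Finset.univ (trueSubgraph x y))).trans ?_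
    rw [← hm]
    have hm0 : 0 ≤ m := by positivity
    have h1 : (n : ℝ) ^ 2 + n * m ≤ (1 + m) * n ^ 2 := by
      have : n * m ≤ n ^ 2 * m := by gcongr; nlinarith
      linarith
    have h2 : Real.exp (-(δ ^ 2 / 8) * n) ≤ Real.exp (-b * n) := by
      gcongr
      exact min_le_right _ _
    calc ((n : ℝ) ^ 2 + n * m) * (2 * Real.exp (-(δ ^ 2 / 8) * n))
        ≤ ((1 + m) * n ^ 2) * (2 * Real.exp (-b * n)) := by gcongr
      _ = _ := by ring
  -- Subadditivity on a cover avoids any measurability of the good event.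
  have hcover : (Set.univ : Set (Ω n)) ⊆
      {ω | GoodSample x (w / 2) δ N (fun i => X n i ω) (A n ω)} ∪ (B₀ ∪ (B₁ ∪ B₂)) := by
    intro ω _
    by_cases h0 : ω ∈ B₀
    · exact Or.inr (Or.inl h0)
    by_cases h1 : ω ∈ B₁
    · exact Or.inr (Or.inr (Or.inl h1))
    by_cases h2 : ω ∈ B₂
    · exact Or.inr (Or.inr (Or.inr h2))
    left
    have h0' : ∀ i, X n i ω ∈ T := fun i => by
      by_contra hi
      exact h0 (Set.mem_iUnion.2 ⟨i, hi⟩)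
    refine ⟨hnN, fun i => (hTmem _).1 (h0' i), fun r k =>
      ⟨Finset.univ.filter fun i => X n i ω = x r k, fun i hi => (Finset.mem_filter.1 hi).2, ?_⟩, ?_⟩
    · by_contra hlt
      exact h1 (Set.mem_iUnion.2 ⟨(r, k), not_le.1 hlt⟩)
    · by_contra hb
      exact h2 ⟨h0', hb⟩
  have h1 : (1 : ℝ) ≤ (μ n).real {ω | GoodSample x (w / 2) δ N (fun i => X n i ω) (A n ω)} +
      (μ n).real (B₀ ∪ (B₁ ∪ B₂)) := by
    have := (measureReal_mono hcover (measure_ne_top (μ n) _)).trans (measureReal_union_le _ _)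
    rwa [probReal_univ] at this
  have h2 : (μ n).real (B₀ ∪ (B₁ ∪ B₂)) ≤
      (R * K + 2 * (1 + m)) * n ^ 2 * Real.exp (-b * n) := by
    refine (measureReal_union_le _ _).trans ?_
    rw [hB₀, zero_add]
    refine (measureReal_union_le _ _).trans ((add_le_add hB₁ hB₂).trans ?_)
    have h3 : (1 : ℝ) ≤ n ^ 2 := one_le_pow₀ hn1
    have h4 : (R : ℝ) * K * Real.exp (-b * n) ≤ (R : ℝ) * K * n ^ 2 * Real.exp (-b * n) :=
      mul_le_mul_of_nonneg_right (le_mul_of_one_le_right (by positivity) h3) (Real.exp_pos _).le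
    linarith [add_mul ((R : ℝ) * K * n ^ 2) (2 * (1 + m) * n ^ 2) (Real.exp (-b * n)),
      add_mul ((R : ℝ) * K) (2 * (1 + m)) ((n : ℝ) ^ 2)]
  have h3 := hn₁ n hnn₁
  linarith

end BlockModel

/-! ### Embedding of typical samples and proof of the theorem. -/

section MainTheorem

/-- Lets the frame bound be applied inside the span of the positions, a proper subspace for a single
subgraph in general. -/
theorem span_range_subtype_eq_top {κ E : Type*} [AddCommGroup E] [Module ℝ E] (x : κ → E) :
    Submodule.span ℝ (Set.range fun k =>
      (⟨x k, Submodule.subset_span ⟨k, rfl⟩⟩ : Submodule.span ℝ (Set.range x))) = ⊤ := by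
  apply Submodule.map_injective_of_injective
    (Submodule.injective_subtype (Submodule.span ℝ (Set.range x)))
  rw [Submodule.map_span, ← Set.range_comp, Submodule.map_top, Submodule.range_subtype]
  rfl

/-- Spectral embeddings recover the Gram matrix of latent positions with finitely many values, each
of them taken by a positive proportion of the vertices. -/
theorem exists_embedding_close {κ ι : Type*} [Fintype κ] [Fintype ι]
    (x : κ → EuclideanSpace ℝ ι) {w τ : ℝ} (hw : 0 < w) (hτ : 0 < τ) :
    ∃ δ : ℝ, 0 < δ ∧ ∃ N : ℕ, ∀ (n : ℕ), N ≤ n → ∀ (C : Type) (S : C → Finset (Fin n))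
      (X : Fin n → EuclideanSpace ℝ ι) (G : SimpleGraph (Fin n)), NoiseBounded δ S X G →
      (∀ i j, inner ℝ (X i) (X j) ∈ Set.Icc (0 : ℝ) 1) →
      ∀ (r : C) (V : Type) [Fintype V] [DecidableEq V] (e : V → Fin n),
      Function.Injective e → (∀ i, i ∈ S r ↔ i ∈ Set.range e) →
      (∀ a, ∃ k, X (e a) = x k) →
      (∀ k, ∃ B ⊆ S r, (∀ i ∈ B, X i = x k) ∧ w * n ≤ B.card) →
      ∀ (m : ℕ), Module.finrank ℝ (Submodule.span ℝ (Set.range x)) = m →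
      ∀ (Xhat : V → EuclideanSpace ℝ (Fin m)), IsASE ((adjacency G).submatrix e e) Xhat →
      ∀ a b, |inner ℝ (Xhat a) (Xhat b) - inner ℝ (X (e a)) (X (e b))| ≤ τ := by
  classical
  obtain ⟨l, hl, hframe⟩ := exists_lower_frame_bound _ (span_range_subtype_eq_top x)
  obtain ⟨δ, hδ, N, h⟩ := exists_noise_level (ι := ι)
    (l := l * w / (Fintype.card κ + 1)) (τ := τ) (by positivity) hτ
  refine ⟨δ, hδ, N, ?_⟩
  intro n hn C S X G hnoise hX r V _ _ e he hS hval hcount m hm Xhat hASE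
  have hW : ∀ a, X (e a) ∈ Submodule.span ℝ (Set.range x) := fun a => by
    obtain ⟨k, hk⟩ := hval a
    rw [hk]
    exact Submodule.subset_span ⟨k, rfl⟩
  refine h n hn C S X G hnoise hX r V e he hS _ hW ?_ m hm Xhat hASE
  refine lower_frame_bound_of_count hframe hw.le (Nat.cast_nonneg n) fun k => ?_
  obtain ⟨B, hB, hBx, hc⟩ := hcount k
  refine ⟨Finset.univ.filter fun a => e a ∈ B, fun a ha => ?_, hc.trans (le_of_eq ?_)⟩
  · exact Subtype.ext (hBx _ (Finset.mem_filter.1 ha).2)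
  · rw [← Finset.card_image_of_injective _ he]
    congr 2
    ext i
    simp only [Finset.mem_image, Finset.mem_filter, Finset.mem_univ, true_and]
    constructor
    · intro hi
      obtain ⟨a, rfl⟩ := (hS i).1 (hB hi)
      exact ⟨a, hi, rfl⟩
    · rintro ⟨a, ha, rfl⟩
      exact ha

variable {R K : ℕ} {ι : Type*} [Fintype ι] {x : Fin R → Fin K → EuclideanSpace ℝ ι}

theorem mem_trueSubgraph {n : ℕ} {X : Fin n → EuclideanSpace ℝ ι} {r : Fin R} {i : Fin n} :
    i ∈ trueSubgraph x X r ↔ ∃ k, X i = x r k := by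
  simp [trueSubgraph]

theorem GoodSample.mono {w δ δ' : ℝ} {N N' n : ℕ} {X : Fin n → EuclideanSpace ℝ ι}
    {G : SimpleGraph (Fin n)} (h : GoodSample x w δ N X G) (hδ : δ ≤ δ') (hN : N' ≤ N) :
    GoodSample x w δ' N' X G where
  large := hN.trans h.large
  mem := h.mem
  count := h.count
  noise := ⟨fun i j hij => (h.noise.1 i j hij).trans (by gcongr),
    fun i r a => (h.noise.2 i r a).trans (by gcongr)⟩

theorem GoodSample.inner_mem {w δ : ℝ} {N n : ℕ} {X : Fin n → EuclideanSpace ℝ ι}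
    {G : SimpleGraph (Fin n)} (h : GoodSample x w δ N X G)
    (hx : ∀ r k s l, inner ℝ (x r k) (x s l) ∈ Set.Icc (0 : ℝ) 1) (i j : Fin n) :
    inner ℝ (X i) (X j) ∈ Set.Icc (0 : ℝ) 1 := by
  obtain ⟨r, k, hi⟩ := h.mem i
  obtain ⟨s, l, hj⟩ := h.mem j
  rw [hi, hj]
  exact hx r k s l

/-- On typical samples the clustering is perfect. -/
theorem exists_perfect_clustering {d : ℕ} {w : ℝ} (hw : 0 < w)
    (hx : ∀ r k s l, inner ℝ (x r k) (x s l) ∈ Set.Icc (0 : ℝ) 1) (hK : 0 < K)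
    (hspan : Submodule.span ℝ (Set.range fun p : Fin R × Fin K => x p.1 p.2) = ⊤)
    (hcard : Fintype.card ι = R * d) (haff : Affinity x) :
    ∃ δ : ℝ, 0 < δ ∧ ∃ N : ℕ, ∀ (n : ℕ) (X : Fin n → EuclideanSpace ℝ ι)
      (G : SimpleGraph (Fin n)), GoodSample x w δ N X G → ∀ run : AlgorithmRun R d G,
      ∃ σ : Equiv.Perm (Fin R), ∀ r, run.Hhat (σ r) = trueSubgraph x X r := by
  classical
  obtain ⟨p, q, hq, hp, hpq⟩ := haff
  have hin : ∀ r k l, q ≤ inner ℝ (x r k) (x r l) := fun r k l => hq.2 ⟨r, k, l, rfl⟩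
  have hout : ∀ r s k l, r ≠ s → inner ℝ (x r k) (x s l) ≤ p := fun r s k l hrs =>
    hp.2 ⟨r, s, k, l, hrs, rfl⟩
  obtain ⟨δ, hδ, N, h⟩ := exists_embedding_close (fun p : Fin R × Fin K => x p.1 p.2) hw
    -- Half the distance from the threshold `(p + q) / 2` to `p` and to `q`, so strict separation
    -- survives.
    (show 0 < (q - p) / 4 by linarith)
  refine ⟨δ, hδ, max N 1, fun n X G hgood run => ?_⟩
  have hn0 : (0 : ℝ) < n := by
    have := (le_max_right N 1).trans hgood.large
    exact_mod_cast this
  choose cl kl hcl using hgood.mem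
  -- Affinity forbids a position common to two subgraphs: its squared norm would be at most `p` and
  -- at least `q`.
  have hclass : ∀ i r, (∃ k, X i = x r k) ↔ cl i = r := fun i r => by
    constructor
    · rintro ⟨k, hk⟩
      by_contra hne
      have h1 := hout (cl i) r (kl i) k hne
      rw [← hcl i, hk] at h1
      linarith [hin r k k]
    · rintro rfl
      exact ⟨kl i, hcl i⟩
  have hclose : ∀ i j, |inner ℝ (run.Xhat i) (run.Xhat j) - inner ℝ (X i) (X j)| ≤
      (q - p) / 4 := by
    refine h n ((le_max_left _ _).trans hgood.large) (Option (Fin R)) _ X G hgood.noise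
      (hgood.inner_mem hx) none (Fin n) id Function.injective_id (by simp)
      (fun i => ⟨(cl i, kl i), hcl i⟩) (fun p => ?_) (R * d) ?_ run.Xhat
      (by rw [Matrix.submatrix_id_id]; exact run.isASE)
    · obtain ⟨B, hB, hc⟩ := hgood.count p.1 p.2
      exact ⟨B, Finset.subset_univ _, hB, hc⟩
    · rw [hspan, finrank_top, finrank_euclideanSpace, hcard]
  have hsep : SeparatesClasses run.Xhat cl ((p + q) / 2) := by
    refine ⟨fun i j hij => ?_, fun i j hij => ?_⟩
    · have h1 := hin (cl i) (kl i) (kl j)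
      have h2 := (abs_le.1 (hclose i j)).1
      rw [hcl i, hcl j, ← hij] at h2
      linarith
    · have h1 := hout (cl i) (cl j) (kl i) (kl j) hij
      have h2 := (abs_le.1 (hclose i j)).2
      rw [hcl i, hcl j] at h2
      linarith
  have hsurj : Function.Surjective cl := fun r => by
    obtain ⟨B, hB, hc⟩ := hgood.count r ⟨0, hK⟩
    have hpos : 0 < B.card := by
      have : (0 : ℝ) < B.card := lt_of_lt_of_le (by positivity) hc
      exact_mod_cast this
    obtain ⟨i, hi⟩ := Finset.card_pos.1 hpos
    exact ⟨i, (hclass i r).1 ⟨_, hB i hi⟩⟩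
  obtain ⟨σ, hσ⟩ := run.exists_perm_of_separatesClasses hsurj hsep
  refine ⟨σ, fun r => ?_⟩
  rw [hσ r]
  ext i
  rw [mem_trueSubgraph, hclass]
  simp

/-- On typical samples, spectral embeddings of the subgraphs are close to aligned latent
positions. -/
theorem exists_aligned_close {d : ℕ} {w ε : ℝ} (hw : 0 < w) (hε : 0 < ε)
    (hx : ∀ r k s l, inner ℝ (x r k) (x s l) ∈ Set.Icc (0 : ℝ) 1) (r : Fin R)
    (hd : Module.finrank ℝ (Submodule.span ℝ (Set.range (x r))) = d) :
    ∃ δ : ℝ, 0 < δ ∧ ∃ N : ℕ, ∀ (n : ℕ) (X : Fin n → EuclideanSpace ℝ ι)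
      (G : SimpleGraph (Fin n)), GoodSample x w δ N X G →
      ∀ H : Finset (Fin n), H = trueSubgraph x X r →
      ∀ Xhat Y : Fin n → EuclideanSpace ℝ (Fin d),
      IsASE ((adjacency G).submatrix (fun v : {i // i ∈ H} => (v : Fin n))
        (fun v : {i // i ∈ H} => (v : Fin n))) (fun v : {i // i ∈ H} => Xhat v) →
      IsAlignedLatent H X Xhat Y → ∀ i ∈ H, ‖Xhat i - Y i‖ ≤ ε := by
  classical
  obtain ⟨τ, hτ, halign⟩ := IsAlignedLatent.exists_norm_sub_le (d := d) (x r) hw hε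
  obtain ⟨δ, hδ, N, h⟩ := exists_embedding_close (x r) hw hτ
  refine ⟨δ, hδ, N, fun n X G hgood H hH Xhat Y hASE hY => ?_⟩
  have hval : ∀ i ∈ H, ∃ k, X i = x r k := fun i hi => mem_trueSubgraph.1 (hH ▸ hi)
  have hcount : ∀ k, ∃ B ⊆ H, (∀ i ∈ B, X i = x r k) ∧ w * n ≤ B.card := fun k => by
    obtain ⟨B, hB, hc⟩ := hgood.count r k
    exact ⟨B, fun i hi => by rw [hH, mem_trueSubgraph]; exact ⟨k, hB i hi⟩, hB, hc⟩
  refine halign n H X Xhat Y hval hcount (fun i hi j hj => ?_) hY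
  exact h n hgood.large (Option (Fin R)) _ X G hgood.noise (hgood.inner_mem hx) (some r)
    {i // i ∈ H} (fun v => (v : Fin n)) Subtype.val_injective
    (fun i => by simp [hH]) (fun a => hval a a.2) (by simpa [hH] using hcount) d hd
    (fun v => Xhat v) hASE ⟨i, hi⟩ ⟨j, hj⟩

end MainTheorem

theorem mainTheorem6
    {R K d M : ℕ}
    (π : Fin R → ℝ) (πs : Fin R → Fin K → ℝ)
    (ξ : Fin R → Fin K → Fin d → ℝ) (𝒜 : Fin R → Fin K → Fin R × Fin d → ℝ)
    (hπ : ∀ r, 0 < π r) (hπ_sum : ∑ r, π r = 1)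
    (hπs : ∀ r k, 0 < πs r k) (hπs_sum : ∀ r, ∑ k, πs r k = 1)
    (h_hadamard : ∀ r k c, blockDiagEntry ξ r k c * 𝒜 r k c = 0)
    (h_affinity : Affinity (latentPosition ξ 𝒜))
    (h_rank : (secondMoment (hsbmLaw π πs (latentPosition ξ 𝒜))).rank = R * d)
    (h_motifs : (Set.range ξ).ncard = M)
    (φ : ℝ → ℝ) (hφ : Continuous φ)
    {Ω : ℕ → Type*} [∀ n, MeasurableSpace (Ω n)]
    (μ : ∀ n, Measure (Ω n)) [∀ n, IsProbabilityMeasure (μ n)]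
    (X : ∀ n, Fin n → Ω n → EuclideanSpace ℝ (Fin R × Fin d))
    (A : ∀ n, Ω n → SimpleGraph (Fin n))
    (h_rdpg : ∀ n, IsRDPG (hsbmLaw π πs (latentPosition ξ 𝒜)) (μ n) (X n) (A n)) :
    AsympAlmostSurely μ (fun n => {ω | ∀ run : AlgorithmRun R d (A n ω),
      ∃ σ : Equiv.Perm (Fin R), ∀ r,
        run.Hhat (σ r) = trueSubgraph (latentPosition ξ 𝒜) (fun i => X n i ω) r}) ∧
    ((∀ r, Module.finrank ℝ (Submodule.span ℝ (Set.range (latentPosition ξ 𝒜 r))) ≤ d) →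
      ∀ ε : ℝ, 0 < ε →
        AsympAlmostSurely μ (fun n => {ω | ∀ run : AlgorithmRun R d (A n ω),
          ∃ σ : Equiv.Perm (Fin R),
            (∀ r, run.Hhat (σ r) = trueSubgraph (latentPosition ξ 𝒜) (fun i => X n i ω) r) ∧
            ∀ Y : Fin R → Fin n → EuclideanSpace ℝ (Fin d),
              (∀ r, IsAlignedLatent (trueSubgraph (latentPosition ξ 𝒜) (fun i => X n i ω) r)
                (fun i => X n i ω) (run.XhatSub (σ r)) (Y r)) →
              ∀ r s, |run.Shat φ (σ r) (σ s) -
                dissimilarity φ (trueSubgraph (latentPosition ξ 𝒜) (fun i => X n i ω)) Y r s|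
                  ≤ ε})) := by
  classical
  set x := latentPosition ξ 𝒜
  have hK : 0 < K := by
    obtain ⟨_, _, hq, -⟩ := h_affinity
    obtain ⟨_, k, _⟩ := hq.1
    exact k.pos
  obtain ⟨w, hw, hwle⟩ := exists_pos_forall_le (f := fun p : Fin R × Fin K => π p.1 * πs p.1 p.2)
    fun p => mul_pos (hπ p.1) (hπs p.1 p.2)
  have hle : ∀ r k, ENNReal.ofReal w ≤ hsbmLaw π πs x {x r k} := fun r k => by
    refine le_trans ?_ (le_hsbmLaw_singleton π πs x r k)
    rw [← ENNReal.ofReal_mul (hπ r).le]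
    exact ENNReal.ofReal_le_ofReal (hwle (r, k))
  have hx : ∀ r k s l, inner ℝ (x r k) (x s l) ∈ Set.Icc (0 : ℝ) 1 := by
    -- Each `x r k` is an atom of the law, so it lies in every set of full measure.
    obtain ⟨𝒳, h0, h1⟩ := (h_rdpg 0).admissible
    have hmem : ∀ r k, x r k ∈ 𝒳 := fun r k => by
      by_contra hn
      have h2 : hsbmLaw π πs x {x r k} = 0 :=
        measure_mono_null (Set.singleton_subset_iff.2 hn) h0
      have h3 := hle r k
      rw [h2, nonpos_iff_eq_zero, ENNReal.ofReal_eq_zero] at h3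
      exact absurd hw (not_lt.2 h3)
    exact fun r k s l => h1 _ (hmem r k) _ (hmem s l)
  have hcard : Fintype.card (Fin R × Fin d) = R * d := by simp
  have hspan := span_eq_top_of_rank_secondMoment π πs x hπ hπs (by rw [h_rank, hcard])
  have hw2 : 0 < w / 2 := by positivity
  obtain ⟨δ₀, hδ₀, N₀, hcluster⟩ := exists_perfect_clustering hw2 hx hK hspan hcard h_affinity
  refine ⟨(asympAlmostSurely_goodSample hw hle hx μ X A h_rdpg hδ₀ N₀).mono
    fun n ω hω => hcluster n _ _ hω, fun hdim ε hε => ?_⟩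
  have hsup : ⨆ r, Submodule.span ℝ (Set.range (x r)) = ⊤ := by
    rw [← Submodule.span_iUnion, ← hspan]
    congr 1
    ext y
    simp
  -- The embedding into `ℝᵈ` must use exactly the rank of the subgraph's Gram matrix; dimension at
  -- most `d` is upgraded to equality.
  have hd := finrank_eq_of_iSup_eq_top _ hsup (by rw [finrank_euclideanSpace, hcard]) hdim
  obtain ⟨γ, hγ, hker⟩ := exists_radial_kernel_close (E := EuclideanSpace ℝ (Fin d)) hφ
    (show 0 < ε / 4 by positivity)
  choose δs hδs Ns halign using fun r => exists_aligned_close (d := d) hw2 hγ hx r (hd r)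
  obtain ⟨δ₁, hδ₁, hδ₁le⟩ := exists_pos_forall_le hδs
  -- One sample event serves the clustering and all `R` subgraph embeddings, so the same `σ` works
  -- for both claims.
  refine (asympAlmostSurely_goodSample hw hle hx μ X A h_rdpg (lt_min hδ₀ hδ₁)
    (max N₀ (Finset.univ.sup Ns))).mono fun n ω hω run => ?_
  have hgood : GoodSample x (w / 2) (min δ₀ δ₁) (max N₀ (Finset.univ.sup Ns))
    (fun i => X n i ω) (A n ω) := hω
  obtain ⟨σ, hσ⟩ := hcluster n _ _ (hgood.mono (min_le_left _ _) (le_max_left _ _)) run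
  refine ⟨σ, hσ, fun Y hY r s => ?_⟩
  have hclose : ∀ r, ∀ i ∈ trueSubgraph x (fun i => X n i ω) r,
      ‖run.XhatSub (σ r) i - Y r i‖ ≤ γ := fun r => by
    have := halign r n _ _ (hgood.mono ((min_le_right _ _).trans (hδ₁le r))
      ((Finset.le_sup (Finset.mem_univ r)).trans (le_max_right _ _))) (run.Hhat (σ r)) (hσ r)
      (run.XhatSub (σ r)) (Y r) (run.isASE_sub (σ r)) (by rw [hσ r]; exact hY r)
    rwa [hσ r] at this
  have hnorm : ∀ r, ∀ i ∈ trueSubgraph x (fun i => X n i ω) r, ‖Y r i‖ ≤ 1 := fun r i hi => by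
    have h1 := (hY r).1 i hi i hi
    have h2 := (hgood.inner_mem hx i i).2
    rw [← h1, real_inner_self_eq_norm_sq] at h2
    exact le_of_sq_le_sq (by simpa using h2) zero_le_one
  have hpair : ∀ r s, ∀ i ∈ trueSubgraph x (fun i => X n i ω) r,
      ∀ j ∈ trueSubgraph x (fun i => X n i ω) s,
      |φ ‖run.XhatSub (σ r) i - run.XhatSub (σ s) j‖ - φ ‖Y r i - Y s j‖| ≤ ε / 4 :=
    fun r s i hi j hj => hker _ _ _ _ (hnorm r i hi) (hnorm s j hj) (hclose r i hi) (hclose s j hj)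
  simp only [AlgorithmRun.Shat, dissimilarity, Matrix.of_apply, hσ]
  refine (abs_testStatistic_sub_le (hpair r r) (hpair r s) (hpair s s) (by positivity)).trans ?_
  linarith
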